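/- Let $d\ge 1$ and let $(p_A)$, with $A$ ranging over the nonempty finite subsets of $\mathbb{Z}^d$, be a family of numbers $p_A\in[0,1)$ that is translation invariant, i.e. $p_{A+v}=p_A$ for all $A$ and all $v\in\mathbb{Z}^d$. Let $(X_A)$ be independent $\{0,1\}$-valued random variables with $\mathbb{P}(X_A=1)=p_A$, and let $\bar X:=\bigcup\{A : X_A=1\}$, regarded as a $\{0,1\}$-valued process on $\mathbb{Z}^d$. A process $Z=(Z_v)_{v\in\mathbb{Z}^d}$ is called a finitary factor of an IID process (FFIID) if there are IID random variables $U=(U_v)_{v\in\mathbb{Z}^d}$ with values in a standard Borel space and a measurable map $F$ such that $F(U)$ has the same distribution as $Z$, $F(U+v)=F(U)+v$ almost surely for every $v\in\mathbb{Z}^d$ (where $+v$ denotes translation of configurations, $(u+v)_w=u_{w-v}$), and there is an almost surely finite stopping time $R$ for the filtration $\mathcal{F}_n=\sigma(U_v:\|v\|_\infty\le n)$, $n \ge 0$, such that $F(U)_0$ is measurable with respect to $\mathcal{F}_R$. **Theorem.** 1. If $p_{\{0\}}>0$ and $\sum_{A\ni 0}p_A\,p_{\{0\}}^{-|A|}<\infty$,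 then $\bar X$ is FFIID. 2. As a consequence, there is a phase transition in the singleton probability. For $q\in[0,1)$ let $\bar X^{(q)}$ denote the process obtained in the same way after $p_{\{v\}}$ is replaced by $q$ for all $v\in\mathbb{Z}^d$, all other $p_A$ being kept. If $\sum_{A\ni 0}p_A e^{\lambda|A|}<\infty$ for some $\lambda>0$, then there is $p_c\in[0,1)$ such that for every $q\in[0,1)$ the process $\bar X^{(q)}$ is FFIID if $q>p_c$ and is not FFIID if $q<p_c$. 3. This phase transition can be nontrivial: in every dimension $d\ge1$ there is a translation invariant family $(p_A)$, $p_A\in[0,1)$, with $\sum_{A\ni 0}p_A e^{\lambda|A|}<\infty$ for some $\lambda>0$, for which 2 holds with $0<p_c<1$. -/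

import Mathlib

open MeasureTheory ProbabilityTheory unitInterval

namespace RandomUnion

/-- The law of a family `X = (X_A)` of independent `{0,1}`-valued random variables, indexed by the
nonempty finite subsets `A` of `V`, with `P(X_A = 1) = p A`.  It is a product measure. The value
`p ∅` is never used. -/
noncomputable def bernoulliFamily {V : Type*} (p : Finset V → I) :
    Measure ({A : Finset V // A.Nonempty} → Bool) :=
  Measure.infinitePi fun A => bernoulliMeasure true false (p A.1)

open Classical in
/-- The union `⋃ {A : X_A = 1}` of the selected sets, as a `{0,1}`-valued configuration on `V`. -/
noncomputable def union {V : Type*} (X : {A : Finset V // A.Nonempty} → Bool) : V → Bool :=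
  fun v => decide (∃ A : {A : Finset V // A.Nonempty}, v ∈ A.1 ∧ X A = true)

theorem measurable_union {V : Type*} [Countable V] : Measurable (union (V := V)) := by
  refine measurable_pi_iff.2 fun v => measurable_to_bool ?_
  have h : (fun X : {A : Finset V // A.Nonempty} → Bool => union X v) ⁻¹' {true}
      = ⋃ A : {A : Finset V // A.Nonempty}, {X | v ∈ A.1 ∧ X A = true} := by
    ext X
    simp [union]
  rw [h]
  refine MeasurableSet.iUnion fun A => (MeasurableSet.const _).inter ?_
  exact (measurable_pi_apply (X := fun _ => Bool) A) (measurableSet_singleton true)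

/-- The law on `{0,1}^V` of the random union. -/
noncomputable def unionLaw {V : Type*} (p : Finset V → I) : Measure (V → Bool) :=
  (bernoulliFamily p).map union

/-- Translation of a configuration on `ℤ^d` by `v`. -/
def shift {d : ℕ} {S : Type*} (v : Fin d → ℤ) (u : (Fin d → ℤ) → S) : (Fin d → ℤ) → S :=
  fun w => u (w - v)

/-- The filtration `F_n = σ(U_v : ‖v‖ ≤ n)` on `S^(ℤ^d)`, where `‖v‖` is the sup norm. -/
def ballFiltration (d : ℕ) (S : Type*) [MeasurableSpace S] :
    Filtration ℕ (MeasurableSpace.pi : MeasurableSpace ((Fin d → ℤ) → S)) where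
  seq n := cylinderEvents {v : Fin d → ℤ | ‖v‖ ≤ (n : ℝ)}
  mono' _ _ h := cylinderEvents_mono fun _ hv =>
    le_trans (Set.mem_ofPred_eq ▸ hv) (Nat.cast_le.2 h)
  le' _ := cylinderEvents_le_pi

/-- A law `ν` on `{0,1}^(ℤ^d)` is that of a finitary factor of an IID process: there are an IID
process `U = (U_v)`, `v ∈ ℤ^d`, with values in a standard Borel space, a measurable map `F` that
commutes almost surely with translations and sends the law of `U` to `ν`, and an almost surely
finite stopping time `R` for the filtration `σ(U_v : ‖v‖ ≤ n)` (the coding radius) such that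
`F(U)_0` is measurable with respect to the σ-algebra of `R`. -/
def IsFinitaryFactorOfIID {d : ℕ} (ν : Measure ((Fin d → ℤ) → Bool)) : Prop :=
  ∃ (S : Type) (_ : MeasurableSpace S) (_ : StandardBorelSpace S)
    (μ : Measure S) (_ : IsProbabilityMeasure μ)
    (F : ((Fin d → ℤ) → S) → ((Fin d → ℤ) → Bool))
    (R : ((Fin d → ℤ) → S) → WithTop ℕ)
    (hR : IsStoppingTime (ballFiltration d S) R),
    Measurable F ∧
    (Measure.infinitePi fun _ : Fin d → ℤ => μ).map F = ν ∧
    (∀ v : Fin d → ℤ, ∀ᵐ u ∂(Measure.infinitePi fun _ : Fin d → ℤ => μ),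
      F (shift v u) = shift v (F u)) ∧
    (∀ᵐ u ∂(Measure.infinitePi fun _ : Fin d → ℤ => μ), R u ≠ ⊤) ∧
    Measurable[hR.measurableSpace] (fun u => F u 0)

/-- `p_{A+v} = p_A` for all nonempty finite `A ⊆ ℤ^d` and all `v ∈ ℤ^d`. -/
def TranslationInvariant {d : ℕ} (p : Finset (Fin d → ℤ) → I) : Prop :=
  ∀ (A : Finset (Fin d → ℤ)) (v : Fin d → ℤ), A.Nonempty →
    p (A.map (addRightEmbedding v)) = p A

/-- The family obtained from `p` by giving every singleton the probability `q`. -/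
def withSingletons {V : Type*} (p : Finset V → I) (q : I) : Finset V → I :=
  fun A => if A.card = 1 then q else p A

/-- `c` is a threshold for the singleton probability: when all `p A` with `|A| > 1` are kept and
every singleton gets probability `q ∈ [0,1)`, the random union is a finitary factor of an IID
process if `q > c`, and it is not if `q < c`. -/
def IsSingletonThreshold {d : ℕ} (p : Finset (Fin d → ℤ) → I) (c : ℝ) : Prop :=
  ∀ q : I, (q : ℝ) < 1 →
    (c < q → IsFinitaryFactorOfIID (unionLaw (withSingletons p q))) ∧
    ((q : ℝ) < c → ¬ IsFinitaryFactorOfIID (unionLaw (withSingletons p q)))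

/-- `∑_{A ∋ 0} p_A e^{λ |A|} < ∞` for some `λ > 0`. -/
def HasExponentialMoment {d : ℕ} (p : Finset (Fin d → ℤ) → I) : Prop :=
  ∃ l : ℝ, 0 < l ∧
    Summable fun A : {A : Finset (Fin d → ℤ) // 0 ∈ A} =>
      (p A.1 : ℝ) * Real.exp (l * (A.1.card : ℝ))

end RandomUnion

/-! The sufficient condition rests on revealing the sets one at a time, starting from the
Bernoulli(q) field of the singletons, q = p_{0}. To decide whether A, of prior probability p, is
selected, its sites are examined in order. A site is covered by A or by the field with probability p
+ (1-p)q; this is realised by letting it pass if the field is 1 there or an extra coin is at most p.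
At the first site that does not pass, A is rejected. Otherwise p is replaced by the posterior p/(p +
(1-p)q), and after the last site a coin decides. If A is selected, the field on A is resampled; if
not, the examined sites keep what was seen. By Bayes' rule the new field is again Bernoulli(q) and
independent of the selection (`lintegral_reveal`), so the procedure can be iterated. The union can
change at a site only if the extra coin of that site is at most p_A q^{-|A|} (`reveal_or_of_lt`).
Under the summability hypothesis, Borel-Cantelli leaves finitely many sets that can affect the
origin (`ae_exists_isFinal`).

For equivariance, fix an enumeration in which every finite set recurs infinitely often. At time n
the translates of the n-th set by random, well separated centres are revealed simultaneously, unless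
revealed before. Every set is eventually revealed (`ae_exists_treated`), and the state at a finite
time depends locally on the input (`exists_dependence`). Given the centres, this state agrees on
each finite set with a finite sequential revelation (`exists_sequential`), so its vanishing
probabilities converge to those of the union (`map_originValue`).

For the threshold, raising q amounts to superposing independent noise, which preserves finitary
codings (`IsFinitaryFactorOfIID.noise`). The good values of q thus form an up-set, which contains
e^{-λ} by the sufficient condition; p_c is its infimum.

For nontriviality, a finitary coding makes the values at distant sites nearly independent: if x
exceeds the density, all sites of a sparse set A are occupied with probability at most x^{|A|}
(`IsFinitaryFactorOfIID.exists_le_pow`). Selecting progressions of n points at spacing n with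
probability 10^{-(n+1)} violates this for x = 1/20 when q is small. -/

namespace RandomUnion

/-! ### Product measures: resampling, independence, dependence on coordinates -/

section Product

variable {ι : Type*} {X : ι → Type*} [∀ i, MeasurableSpace (X i)]
  (μ : ∀ i, Measure (X i)) [∀ i, IsProbabilityMeasure (μ i)]

open Classical in
theorem measurable_piecewise (J : Set ι) :
    Measurable fun z : (∀ i, X i) × (∀ i, X i) => J.piecewise z.1 z.2 := by
  refine measurable_pi_iff.2 fun i => ?_
  by_cases h : i ∈ J
  · simp only [Set.piecewise, h, if_true]; fun_prop
  · simp only [Set.piecewise, h, if_false]; fun_prop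

open Classical in
/-- Choosing the coordinates in `J` from one copy of a product measure and the others from an
independent copy gives the same product measure. -/
theorem map_piecewise_infinitePi (J : Set ι) :
    ((Measure.infinitePi μ).prod (Measure.infinitePi μ)).map (fun z => J.piecewise z.1 z.2)
      = Measure.infinitePi μ := by
  refine Measure.eq_infinitePi μ fun s t ht => ?_
  rw [Measure.map_apply (measurable_piecewise J) (.pi s.countable_toSet fun i _ => ht i)]
  have : (fun z : (∀ i, X i) × (∀ i, X i) => J.piecewise z.1 z.2) ⁻¹' (Set.pi s t)
      = (Set.pi ((s.filter (· ∈ J) : Finset ι) : Set ι) t) ×ˢ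
        (Set.pi ((s.filter (· ∉ J) : Finset ι) : Set ι) t) := by
    ext z
    simp only [Set.mem_preimage, Set.mem_pi, Set.mem_prod, Finset.coe_filter, Set.mem_ofPred_eq,
      Finset.mem_coe]
    constructor
    · intro h
      refine ⟨fun i hi => ?_, fun i hi => ?_⟩
      · have := h i hi.1; rwa [Set.piecewise_eq_of_mem _ _ _ hi.2] at this
      · have := h i hi.1; rwa [Set.piecewise_eq_of_notMem _ _ _ hi.2] at this
    · rintro ⟨h1, h2⟩ i hi
      by_cases h : i ∈ J
      · rw [Set.piecewise_eq_of_mem _ _ _ h]; exact h1 i ⟨hi, h⟩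
      · rw [Set.piecewise_eq_of_notMem _ _ _ h]; exact h2 i ⟨hi, h⟩
  rw [this, Measure.prod_prod, Measure.infinitePi_pi _ (fun i _ => ht i),
    Measure.infinitePi_pi _ (fun i _ => ht i), Finset.prod_filter_mul_prod_filter_not]

open Classical in
theorem lintegral_infinitePi_piecewise (J : Set ι) {f : (∀ i, X i) → ENNReal}
    (hf : Measurable f) :
    ∫⁻ u, f u ∂(Measure.infinitePi μ)
      = ∫⁻ u, ∫⁻ w, f (J.piecewise u w) ∂(Measure.infinitePi μ) ∂(Measure.infinitePi μ) := by
  conv_lhs => rw [← map_piecewise_infinitePi μ J, lintegral_map hf (measurable_piecewise J)]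
  exact lintegral_prod _ (hf.comp (measurable_piecewise J)).aemeasurable

/-- Resampling one coordinate does not change a product measure. -/
theorem lintegral_infinitePi_update [DecidableEq ι] (i : ι) {f : (∀ i, X i) → ENNReal}
    (hf : Measurable f) :
    ∫⁻ u, f u ∂(Measure.infinitePi μ)
      = ∫⁻ u, ∫⁻ x, f (Function.update u i x) ∂(μ i) ∂(Measure.infinitePi μ) := by
  classical
  rw [lintegral_infinitePi_piecewise μ {i}ᶜ hf]
  refine lintegral_congr fun u => ?_
  rw [← Measure.infinitePi_map_eval μ i, lintegral_map]
  · refine lintegral_congr fun w => congrArg f ?_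
    ext j
    by_cases h : j = i
    · subst h; simp [Set.piecewise]
    · simp [Set.piecewise, h]
  · exact hf.comp (measurable_update u)
  · exact measurable_pi_apply i

/-- A set of configurations is determined by the coordinates in `J`. -/
def DependsOnCoords (J : Set ι) (A : Set (∀ i, X i)) : Prop :=
  ∀ u w, (∀ i ∈ J, u i = w i) → u ∈ A → w ∈ A

theorem infinitePi_inter_of_dependsOn {J : Set ι} {A B : Set (∀ i, X i)}
    (hA : MeasurableSet A) (hB : MeasurableSet B)
    (hAJ : DependsOnCoords J A) (hBJ : DependsOnCoords Jᶜ B) :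
    Measure.infinitePi μ (A ∩ B) = Measure.infinitePi μ A * Measure.infinitePi μ B := by
  classical
  -- Splice two independent copies along J: A reads only the first, B only the second.
  conv_lhs => rw [← map_piecewise_infinitePi μ J,
    Measure.map_apply (measurable_piecewise J) (hA.inter hB)]
  rw [← Measure.prod_prod]
  congr 1
  ext z
  have h1 : J.piecewise z.1 z.2 ∈ A ↔ z.1 ∈ A :=
    ⟨hAJ _ _ fun i hi => Set.piecewise_eq_of_mem _ _ _ hi,
      hAJ _ _ fun i hi => (Set.piecewise_eq_of_mem _ _ _ hi).symm⟩
  have h2 : J.piecewise z.1 z.2 ∈ B ↔ z.2 ∈ B :=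
    ⟨hBJ _ _ fun i hi => Set.piecewise_eq_of_notMem _ _ _ hi,
      hBJ _ _ fun i hi => (Set.piecewise_eq_of_notMem _ _ _ hi).symm⟩
  simp [h1, h2]

/-- Serves twice: for the trials at different times in `ae_exists_treated`, and for events in
disjoint balls in `IsFinitaryFactorOfIID.exists_le_pow`. -/
theorem infinitePi_biInter_of_dependsOn {κ : Type*} (s : Finset κ) (J : κ → Set ι)
    (A : κ → Set (∀ i, X i)) (hA : ∀ k ∈ s, MeasurableSet (A k))
    (hAJ : ∀ k ∈ s, DependsOnCoords (J k) (A k))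
    (hJ : (s : Set κ).PairwiseDisjoint J) :
    Measure.infinitePi μ (⋂ k ∈ s, A k) = ∏ k ∈ s, Measure.infinitePi μ (A k) := by
  classical
  induction s using Finset.induction_on with
  | empty => simp
  | insert a s ha ih =>
    rw [Finset.set_biInter_insert, Finset.prod_insert ha,
      infinitePi_inter_of_dependsOn μ (J := J a) (hA a (by simp)), ih]
    · exact fun k hk => hA k (by simp [hk])
    · exact fun k hk => hAJ k (by simp [hk])
    · exact hJ.subset (by simp)
    · exact s.measurableSet_biInter fun k hk => hA k (by simp [hk])
    · exact hAJ a (by simp)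
    · intro u w h hu
      simp only [Set.mem_iInter] at hu ⊢
      intro k hk
      refine hAJ k (by simp [hk]) u w (fun i hi => h i fun hia => ?_) (hu k hk)
      have := hJ (x := a) (y := k) (by simp) (by simp [hk]) (by rintro rfl; exact ha hk)
      exact Set.disjoint_left.1 this hia hi

/-- A measurable function that only depends on the coordinates in `J` is measurable with respect
to the σ-algebra of these coordinates. -/
theorem measurable_cylinderEvents_of_dependsOn [∀ i, Nonempty (X i)] {β : Type*}
    [MeasurableSpace β] {J : Set ι}
    {f : (∀ i, X i) → β} (hf : Measurable f) (h : ∀ u w, (∀ i ∈ J, u i = w i) → f u = f w) :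
    Measurable[cylinderEvents J] f := by
  classical
  let x0 : ∀ i, X i := fun i => Classical.arbitrary _
  have hm : Measurable[cylinderEvents J] fun u : ∀ i, X i => J.piecewise u x0 := by
    refine @measurable_pi_lambda _ _ _ (cylinderEvents J) _ _ fun i => ?_
    by_cases hi : i ∈ J
    · simp only [Set.piecewise, hi, if_true]
      exact measurable_cylinderEvent_apply hi
    · simp only [Set.piecewise, hi, if_false]
      exact measurable_const
  -- Freezing the coordinates outside J at `x0` does not change f.
  have : f = f ∘ fun u => J.piecewise u x0 := by
    ext u
    exact h _ _ fun i hi => (Set.piecewise_eq_of_mem _ _ _ hi).symm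
  rw [this]
  exact hf.comp hm

/-- If u and w agree on J, the sets that contain both or neither of them form a σ-algebra, and it
contains the generators. -/
theorem dependsOnCoords_of_measurableSet {J : Set ι} {A : Set (∀ i, X i)}
    (hA : MeasurableSet[cylinderEvents J] A) : DependsOnCoords J A := by
  have key : ∀ u w : ∀ i, X i, (∀ i ∈ J, u i = w i) → (u ∈ A ↔ w ∈ A) := by
    intro u w huw
    have : cylinderEvents (X := X) J ≤ MeasurableSpace.mk (fun s => (u ∈ s ↔ w ∈ s)) (by simp)
        (fun s hs => by simp [hs]) (fun f hf => by simp [hf]) := by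
      refine iSup₂_le fun i hi => ?_
      rintro _ ⟨t, -, rfl⟩
      change u i ∈ t ↔ w i ∈ t
      rw [huw i hi]
    exact this A hA
  exact fun u w h => (key u w h).1

end Product

/-! ### Bernoulli variables as thresholded uniform variables -/

section Uniform

/-- The number `p` as an extended nonnegative real. -/
noncomputable def weight (p : I) : ENNReal := ENNReal.ofReal p

theorem coe_toNNReal_eq_weight (p : I) : ((unitInterval.toNNReal p : NNReal) : ENNReal) = weight p := by
  rw [weight, ENNReal.ofReal, ENNReal.coe_inj]
  ext
  simp [p.2.1]

theorem map_decide_le_volume (s : I) :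
    (volume : Measure I).map (fun x => decide (x ≤ s)) = bernoulliMeasure true false s := by
  have hm : Measurable fun x : I => decide (x ≤ s) :=
    measurable_to_bool (by
      have : (fun x : I => decide (x ≤ s)) ⁻¹' {true} = Set.Iic s := by ext; simp
      rw [this]; exact measurableSet_Iic)
  have : IsProbabilityMeasure ((volume : Measure I).map (fun x => decide (x ≤ s))) :=
    Measure.isProbabilityMeasure_map hm.aemeasurable
  have ht : (volume : Measure I).map (fun x => decide (x ≤ s)) {true}
      = bernoulliMeasure true false s {true} := by
    rw [Measure.map_apply hm (measurableSet_singleton _),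
      bernoulliMeasure_apply_of_mem_of_notMem _ (measurableSet_singleton _) (by simp) (by simp)]
    have : (fun x : I => decide (x ≤ s)) ⁻¹' {true} = Set.Iic s := by ext; simp
    rw [this, unitInterval.volume_Iic]
    exact (coe_toNNReal_eq_weight s).symm
  refine Measure.ext_of_singleton fun b => ?_
  cases b
  · have : ({false} : Set Bool) = {true}ᶜ := by ext b; cases b <;> simp
    rw [this, prob_compl_eq_one_sub (measurableSet_singleton _),
      prob_compl_eq_one_sub (measurableSet_singleton _), ht]
  · exact ht

theorem lintegral_bernoulliMeasure_bool (s : I) (f : Bool → ENNReal) :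
    ∫⁻ b, f b ∂(bernoulliMeasure true false s) = weight s * f true + weight (σ s) * f false := by
  rw [bernoulliMeasure_def, lintegral_add_measure, lintegral_smul_measure, lintegral_smul_measure,
    lintegral_dirac, lintegral_dirac, ← coe_toNNReal_eq_weight, ← coe_toNNReal_eq_weight]
  rfl

theorem measurable_decide_le (s : I) : Measurable fun x : I => decide (x ≤ s) :=
  measurable_to_bool (by
    have : (fun x : I => decide (x ≤ s)) ⁻¹' {true} = Set.Iic s := by ext; simp
    rw [this]; exact measurableSet_Iic)

theorem lintegral_decide_le (s : I) (f : Bool → ENNReal) :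
    ∫⁻ x : I, f (decide (x ≤ s)) = weight s * f true + weight (σ s) * f false := by
  rw [← lintegral_bernoulliMeasure_bool, ← map_decide_le_volume,
    lintegral_map (measurable_of_finite f) (measurable_decide_le s)]

end Uniform

/-! ### Laws on {0,1}^V and their vanishing probabilities -/

section Avoid

variable {V : Type*}

/-- The configurations that vanish on `E`. -/
def vanishing (E : Finset V) : Set (V → Bool) := {x | ∀ v ∈ E, x v = false}

theorem measurableSet_vanishing (E : Finset V) : MeasurableSet (vanishing E) := by
  have : vanishing E = ⋂ v ∈ E, (fun x : V → Bool => x v) ⁻¹' {false} := by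
    ext; simp [vanishing]
  rw [this]
  exact E.measurableSet_biInter fun v _ => measurable_pi_apply v (measurableSet_singleton _)

/-- A law on `{0,1}^V` is determined by the probabilities of vanishing on finite sets. -/
theorem ext_of_vanishing {ν ν' : Measure (V → Bool)} [IsProbabilityMeasure ν]
    [IsProbabilityMeasure ν'] (h : ∀ E : Finset V, ν (vanishing E) = ν' (vanishing E)) :
    ν = ν' := by
  classical
  -- Vanishing on E and on E' is vanishing on E ∪ E', so these events form a π-system.
  refine ext_of_generate_finite (Set.range vanishing) ?_ ?_ ?_ (by simp)
  · refine le_antisymm ?_ ?_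
    · refine iSup_le fun v => ?_
      have hv : Measurable[MeasurableSpace.generateFrom (Set.range (vanishing (V := V)))]
          fun x : V → Bool => x v := by
        refine @measurable_to_bool _ (_) _ ?_
        have : (fun x : V → Bool => x v) ⁻¹' {true} = (vanishing {v})ᶜ := by
          ext x; simp [vanishing]
        rw [this]
        exact (MeasurableSpace.measurableSet_generateFrom (Set.mem_range_self _)).compl
      exact hv.comap_le
    · refine MeasurableSpace.generateFrom_le ?_
      rintro _ ⟨E, rfl⟩
      exact measurableSet_vanishing E
  · rintro _ ⟨E, rfl⟩ _ ⟨E', rfl⟩ _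
    refine ⟨E ∪ E', ?_⟩
    ext x
    simp only [vanishing, Finset.mem_union, Set.mem_ofPred_eq, Set.mem_inter_iff]
    exact ⟨fun h => ⟨fun v hv => h v (.inl hv), fun v hv => h v (.inr hv)⟩,
      fun h v hv => hv.elim (h.1 v) (h.2 v)⟩
  · rintro _ ⟨E, rfl⟩
    exact h E

instance (p : Finset V → I) : IsProbabilityMeasure (bernoulliFamily p) := by
  unfold bernoulliFamily; infer_instance

instance [Countable V] (p : Finset V → I) : IsProbabilityMeasure (unionLaw p) :=
  Measure.isProbabilityMeasure_map measurable_union.aemeasurable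

/-- The event that none of the sets in `𝒯` that meet `E` is selected. -/
def noneSelected (𝒯 : Set (Finset V)) (E : Finset V) :
    Set ({A : Finset V // A.Nonempty} → Bool) :=
  {X | ∀ A : {A : Finset V // A.Nonempty}, A.1 ∈ 𝒯 → (∃ v ∈ E, v ∈ A.1) → X A = false}

theorem measurableSet_noneSelected [Countable V] (𝒯 : Set (Finset V)) (E : Finset V) :
    MeasurableSet (noneSelected 𝒯 E) := by
  have : noneSelected 𝒯 E = ⋂ A : {A : Finset V // A.Nonempty}, ⋂ (_ : A.1 ∈ 𝒯),
      ⋂ (_ : ∃ v ∈ E, v ∈ A.1), (fun X => X A) ⁻¹' {false} := by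
    ext
    simp only [noneSelected, Set.mem_ofPred_eq, Set.mem_iInter, Set.mem_preimage,
      Set.mem_singleton_iff]
  rw [this]
  exact MeasurableSet.iInter fun A => .iInter fun _ => .iInter fun _ =>
    measurable_pi_apply A (measurableSet_singleton _)

theorem unionLaw_vanishing [Countable V] (p : Finset V → I) (E : Finset V) :
    unionLaw p (vanishing E) = bernoulliFamily p (noneSelected Set.univ E) := by
  rw [unionLaw, Measure.map_apply measurable_union (measurableSet_vanishing E)]
  congr 1
  ext X
  simp only [vanishing, union, noneSelected, Set.mem_preimage, Set.mem_ofPred_eq,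
    decide_eq_false_iff_not, Set.mem_univ, forall_true_left]
  constructor
  · rintro h A ⟨v, hv, hA⟩
    by_contra hX
    exact h v hv ⟨A, hA, by simpa using hX⟩
  · rintro h v hv ⟨A, hA, hX⟩
    rw [h A ⟨v, hv, hA⟩] at hX
    simp at hX

end Avoid

/-! ### Bayes' rule and the revelation of a single set -/

section Posterior

/-- The probability that a set with prior probability `p` is selected, given that one of its sites
is occupied, when sites outside the selected set are occupied with probability `q`. -/
noncomputable def posterior (q p : I) : I :=
  ⟨(p : ℝ) / (p + (1 - p) * q),
    div_nonneg p.2.1 (add_nonneg p.2.1 (mul_nonneg (sub_nonneg.2 p.2.2) q.2.1)),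
    div_le_one_of_le₀ (le_add_of_nonneg_right (mul_nonneg (sub_nonneg.2 p.2.2) q.2.1))
      (add_nonneg p.2.1 (mul_nonneg (sub_nonneg.2 p.2.2) q.2.1))⟩

theorem le_posterior_denom (q p : I) :
    (q : ℝ) ≤ p + (1 - p) * q := by
  have := mul_nonneg p.2.1 (sub_nonneg.2 q.2.2)
  nlinarith

/-- The denominator is the probability that the site is occupied, which is at least q. Each examined
site thus costs a factor of at most 1/q, the source of q^{-|A|} in the summability hypothesis. -/
theorem posterior_le {q : I} (hq : 0 < (q : ℝ)) (p : I) :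
    (posterior q p : ℝ) ≤ p * (q : ℝ)⁻¹ := by
  rw [← div_eq_mul_inv]
  exact div_le_div_of_nonneg_left p.2.1 hq (le_posterior_denom q p)

theorem weight_add_weight_symm (p : I) : weight p + weight (σ p) = 1 := by
  rw [weight, weight, ← ENNReal.ofReal_add p.2.1 (σ p).2.1]
  simp

/-- Bayes' rule: the first factor is the probability that the site passes, so the product is the
probability that it passes and the set is selected. The companion `weight_symm_posterior` treats the
case of rejection. -/
theorem weight_posterior {q : I} (hq : 0 < (q : ℝ)) (p : I) :
    (weight q + weight (σ q) * weight p) * weight (posterior q p) = weight p := by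
  have h := le_posterior_denom q p
  rw [weight, weight, weight, weight, ← ENNReal.ofReal_mul (σ q).2.1,
    ← ENNReal.ofReal_add q.2.1 (mul_nonneg (σ q).2.1 p.2.1),
    ← ENNReal.ofReal_mul (add_nonneg q.2.1 (mul_nonneg (σ q).2.1 p.2.1))]
  congr 1
  simp only [posterior, coe_symm_eq]
  have : (p : ℝ) + (1 - p) * q ≠ 0 := (hq.trans_le h).ne'
  rw [← mul_div_assoc, div_eq_iff this]
  ring

theorem weight_symm_posterior {q : I} (hq : 0 < (q : ℝ)) (p : I) :
    (weight q + weight (σ q) * weight p) * weight (σ (posterior q p)) =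
      weight q * weight (σ p) := by
  have h := le_posterior_denom q p
  rw [weight, weight, weight, weight, weight, ← ENNReal.ofReal_mul (σ q).2.1,
    ← ENNReal.ofReal_add q.2.1 (mul_nonneg (σ q).2.1 p.2.1),
    ← ENNReal.ofReal_mul (add_nonneg q.2.1 (mul_nonneg (σ q).2.1 p.2.1)),
    ← ENNReal.ofReal_mul q.2.1]
  congr 1
  simp only [posterior, coe_symm_eq]
  have : (p : ℝ) + (1 - p) * q ≠ 0 := (hq.trans_le h).ne'
  rw [one_sub_div this, ← mul_div_assoc, div_eq_iff this]
  ring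

end Posterior

variable {V : Type*} [DecidableEq V]

/-- Sequential revelation of the sites of a list. Given an independent Bernoulli configuration `x`
with parameter `q`, decide whether a set with prior probability `p` is selected, in such a way that
it can only be selected if every site of the list is occupied in `x` or has its coin
`w (some (false, a))` below a small threshold. If the set is selected then its sites are sampled
afresh by means of `w (some (true, a))`, otherwise the sites that were examined keep the value that
was seen. -/
noncomputable def reveal (q : I) (w : Option (Bool × V) → I) :
    List V → I → (V → Bool) → (V → Bool) × Bool
  | [], p, x => (x, decide (w none ≤ p))
  | a :: l, p, x =>
    if x a || decide (w (some (false, a)) ≤ p) then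
      let y := reveal q w l (posterior q p) x
      (Function.update y.1 a (!y.2 || decide (w (some (true, a)) ≤ q)), y.2)
    else (x, false)

theorem reveal_congr (q : I) {w w' : Option (Bool × V) → I} (l : List V) (p : I) (x : V → Bool)
    (h0 : w none = w' none) (h : ∀ a ∈ l, ∀ b, w (some (b, a)) = w' (some (b, a))) :
    reveal q w l p x = reveal q w' l p x := by
  induction l generalizing p with
  | nil => simp [reveal, h0]
  | cons a l ih =>
    simp only [reveal, h a (by simp), ih _ fun a' ha' => h a' (by simp [ha'])]

/-- Only the sites of the list are read and modified. -/
theorem reveal_fst_of_notMem (q : I) (w : Option (Bool × V) → I) (l : List V) (p : I)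
    (x : V → Bool) {v : V} (hv : v ∉ l) : (reveal q w l p x).1 v = x v := by
  induction l generalizing p with
  | nil => rfl
  | cons a l ih =>
    simp only [List.mem_cons, not_or] at hv
    by_cases hc : (x a || decide (w (some (false, a)) ≤ p)) = true
    · simp only [reveal, hc, if_true]
      rw [Function.update_of_ne hv.1, ih _ hv.2]
    · simp [reveal, hc]

theorem reveal_congr_config (q : I) (w : Option (Bool × V) → I) (l : List V) (p : I)
    {x x' : V → Bool} (h : ∀ a ∈ l, x a = x' a) :
    (reveal q w l p x).2 = (reveal q w l p x').2 ∧
      ∀ v, x v = x' v → (reveal q w l p x).1 v = (reveal q w l p x').1 v := by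
  induction l generalizing p with
  | nil => exact ⟨rfl, fun v hv => hv⟩
  | cons a l ih =>
    obtain ⟨h1, h2⟩ := ih (posterior q p) fun a' ha' => h a' (by simp [ha'])
    by_cases hc : (x' a || decide (w (some (false, a)) ≤ p)) = true
    · simp only [reveal, h a (by simp), hc, if_true]
      refine ⟨h1, fun v hv => ?_⟩
      by_cases hva : v = a
      · subst hva; simp [h1]
      · simp only [Function.update_of_ne hva]; exact h2 v hv
    · simp only [reveal, h a (by simp), hc]
      exact ⟨rfl, fun v hv => hv⟩

/-- Where the coin is above the threshold, adding the set does not change the configuration. -/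
theorem reveal_or_of_lt {q : I} (hq : 0 < (q : ℝ)) (w : Option (Bool × V) → I) (l : List V) (p : I)
    (x : V → Bool) (v : V) (hv : (p : ℝ) * ((q : ℝ)⁻¹) ^ l.length < w (some (false, v))) :
    ((reveal q w l p x).1 v || ((reveal q w l p x).2 && decide (v ∈ l))) = x v := by
  induction l generalizing p with
  | nil => simp [reveal]
  | cons a l ih =>
    have h1 : (1 : ℝ) ≤ (q : ℝ)⁻¹ := (one_le_inv₀ hq).2 q.2.2
    have hp : ((posterior q p : I) : ℝ) * ((q : ℝ)⁻¹) ^ l.length < w (some (false, v)) := by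
      refine lt_of_le_of_lt ?_ hv
      rw [List.length_cons, pow_succ', ← mul_assoc]
      exact mul_le_mul_of_nonneg_right (posterior_le hq p) (by positivity)
    have ih := ih _ hp
    by_cases hc : (x a || decide (w (some (false, a)) ≤ p)) = true
    · simp only [reveal, hc, if_true]
      by_cases hva : v = a
      · subst hva
        -- The coin cannot let v pass, so passing forces x v = true. Afterwards v is still covered,
        -- by the set if it is selected and by the kept value otherwise.
        have : ¬ (w (some (false, v)) ≤ p) := by
          rw [not_le, ← Subtype.coe_lt_coe]
          refine lt_of_le_of_lt ?_ hv
          exact le_mul_of_one_le_right p.2.1 (one_le_pow₀ h1)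
        simp only [this, decide_false, Bool.or_false] at hc
        rw [hc]
        cases h : (reveal q w l (posterior q p) x).2 <;> simp
      · simpa [Function.update_of_ne hva, hva] using ih
    · simp [reveal, hc]

theorem measurable_update_bool {α : Type*} [MeasurableSpace α] {y : α → V → Bool} {b : α → Bool}
    (a : V) (hy : Measurable y) (hb : Measurable b) :
    Measurable fun z => Function.update (y z) a (b z) := by
  refine measurable_pi_iff.2 fun v => ?_
  by_cases h : v = a
  · subst h; simpa using hb
  · simpa [Function.update_of_ne h] using measurable_pi_iff.1 hy v

theorem measurable_reveal (q : I) (l : List V) (p : I) :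
    Measurable fun z : (V → Bool) × (Option (Bool × V) → I) => reveal q z.2 l p z.1 := by
  have hd : ∀ (i : Option (Bool × V)) (s : I),
      Measurable fun z : (V → Bool) × (Option (Bool × V) → I) => decide (z.2 i ≤ s) :=
    fun i s => (measurable_decide_le s).comp (by fun_prop)
  induction l generalizing p with
  | nil => exact measurable_fst.prodMk (hd none p)
  | cons a l ih =>
    simp only [reveal]
    have ih := ih (posterior q p)
    have hx : Measurable fun z : (V → Bool) × (Option (Bool × V) → I) => z.1 a := by fun_prop
    refine Measurable.ite ?_ ?_ ?_
    · exact ((measurable_of_finite fun z : Bool × Bool => z.1 || z.2).comp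
        (hx.prodMk (hd _ p))) (measurableSet_singleton true)
    · refine (measurable_update_bool a ih.fst ?_).prodMk ih.snd
      exact (measurable_of_finite fun z : Bool × Bool => !z.1 || z.2).comp
        (ih.snd.prodMk (hd _ q))
    · exact measurable_fst.prodMk measurable_const

theorem lintegral_infinitePi_bernoulli (q : I) (a : V) {g : (V → Bool) → ENNReal}
    (hg : Measurable g) :
    ∫⁻ x, g x ∂(Measure.infinitePi fun _ : V => bernoulliMeasure true false q)
      = ∫⁻ x, (weight q * g (Function.update x a true)
          + weight (σ q) * g (Function.update x a false))
        ∂(Measure.infinitePi fun _ : V => bernoulliMeasure true false q) := by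
  rw [lintegral_infinitePi_update _ a hg]
  exact lintegral_congr fun x => lintegral_bernoulliMeasure_bool q _

/-- Isolates the three variables attached to the head: its value b, the coin c that may let it pass,
and the coin r for resampling. Since a ∉ l, the recursion on the tail reads none of them, so they
can be integrated out. -/
theorem reveal_cons_update (q : I) (w : Option (Bool × V) → I) {a : V} {l : List V} (hal : a ∉ l)
    (p : I) (x : V → Bool) (b : Bool) (c r : I) :
    reveal q (Function.update (Function.update w (some (true, a)) r) (some (false, a)) c)
        (a :: l) p (Function.update x a b)
      = if b || decide (c ≤ p) then
          (Function.update (reveal q w l (posterior q p) x).1 a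
            (!(reveal q w l (posterior q p) x).2 || decide (r ≤ q)),
            (reveal q w l (posterior q p) x).2)
        else (Function.update x a b, false) := by
  have hw : reveal q (Function.update (Function.update w (some (true, a)) r) (some (false, a)) c)
      l (posterior q p) (Function.update x a b)
      = reveal q w l (posterior q p) (Function.update x a b) := by
    refine reveal_congr q l _ _ (by simp) fun a' ha' b' => ?_
    have : a' ≠ a := fun h => hal (h ▸ ha')
    rw [Function.update_of_ne (by simp [this]), Function.update_of_ne (by simp [this])]
  obtain ⟨h2, h1⟩ := reveal_congr_config q w l (posterior q p)
    (x := Function.update x a b) (x' := x) fun a' ha' => by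
      have : a' ≠ a := fun h => hal (h ▸ ha')
      rw [Function.update_of_ne this]
  simp only [reveal, hw, Function.update_self, h2]
  rw [Function.update_of_ne (a := some (true, a)) (a' := some (false, a)) (by simp),
    Function.update_self]
  congr 2
  ext v
  by_cases hv : v = a
  · subst hv; simp
  · simp only [Function.update_of_ne hv]
    exact h1 v (Function.update_of_ne hv _ _)

/-- Revealing all the sites of the list transforms an independent Bernoulli configuration into
an independent Bernoulli configuration together with an independent selection of the set. -/
theorem lintegral_reveal {q : I} (hq : 0 < (q : ℝ)) (l : List V) (hl : l.Nodup) (p : I)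
    {f : (V → Bool) × Bool → ENNReal} (hf : Measurable f) :
    ∫⁻ x, ∫⁻ w, f (reveal q w l p x)
        ∂(Measure.infinitePi fun _ : Option (Bool × V) => (volume : Measure I))
        ∂(Measure.infinitePi fun _ : V => bernoulliMeasure true false q)
      = ∫⁻ x, (weight p * f (x, true) + weight (σ p) * f (x, false))
        ∂(Measure.infinitePi fun _ : V => bernoulliMeasure true false q) := by
  set κ := Measure.infinitePi fun _ : V => bernoulliMeasure true false q
  set ω := Measure.infinitePi fun _ : Option (Bool × V) => (volume : Measure I)
  induction l generalizing p f with
  | nil =>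
    refine lintegral_congr fun x => ?_
    simp only [reveal]
    rw [← lintegral_decide_le p fun b => f (x, b),
      ← Measure.infinitePi_map_eval (fun _ : Option (Bool × V) => (volume : Measure I)) none,
      lintegral_map]
    · exact (hf.comp measurable_prodMk_left).comp (measurable_decide_le p)
    · exact measurable_pi_apply none
  | cons a l ih =>
    obtain ⟨hal, hl⟩ := List.nodup_cons.1 hl
    -- The average of f over the new value of the head, once the tail is revealed.
    set g : (V → Bool) × Bool → ENNReal := fun y =>
      weight q * f (Function.update y.1 a (!y.2 || true), y.2)
        + weight (σ q) * f (Function.update y.1 a (!y.2 || false), y.2) with hg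
    have hupd : ∀ b : Bool, Measurable fun y : (V → Bool) × Bool =>
        f (Function.update y.1 a (!y.2 || b), y.2) := fun b =>
      hf.comp ((measurable_update_bool a measurable_fst
        ((measurable_of_finite fun b' : Bool => !b' || b).comp
          measurable_snd)).prodMk measurable_snd)
    have hgm : Measurable g := ((hupd true).const_mul _).add ((hupd false).const_mul _)
    have hmeas : ∀ l p (x : V → Bool), Measurable fun w => reveal q w l p x :=
      fun l p x => (measurable_reveal q l p).comp measurable_prodMk_left
    have hH : ∀ x, ∫⁻ w, f (Function.update (reveal q w l (posterior q p) x).1 a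
          (!(reveal q w l (posterior q p) x).2 || decide (w (some (true, a)) ≤ q)),
          (reveal q w l (posterior q p) x).2) ∂ω
        = ∫⁻ w, g (reveal q w l (posterior q p) x) ∂ω := by
      intro x
      have hr := hmeas l (posterior q p) x
      rw [lintegral_infinitePi_update _ (some (true, a))]
      · refine lintegral_congr fun w => ?_
        have : ∀ r, reveal q (Function.update w (some (true, a)) r) l (posterior q p) x
            = reveal q w l (posterior q p) x := fun r => by
          refine reveal_congr q l _ _ (by simp) fun a' ha' b' => ?_
          rw [Function.update_of_ne]
          rintro h
          simp only [Option.some.injEq, Prod.mk.injEq] at h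
          exact hal (h.2 ▸ ha')
        simp only [this, Function.update_self]
        exact lintegral_decide_le q fun b => f (Function.update
          (reveal q w l (posterior q p) x).1 a (!(reveal q w l (posterior q p) x).2 || b),
          (reveal q w l (posterior q p) x).2)
      · refine hf.comp ((measurable_update_bool a hr.fst ?_).prodMk hr.snd)
        exact (measurable_of_finite fun z : Bool × Bool => !z.1 || z.2).comp
          (hr.snd.prodMk ((measurable_decide_le q).comp (measurable_pi_apply _)))
    -- Split on whether the head passes: surely if b is true, with probability p otherwise.
    have key : ∀ (x : V → Bool) (b : Bool),
        ∫⁻ w, f (reveal q w (a :: l) p (Function.update x a b)) ∂ω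
        = (if b then 1 else weight p) * ∫⁻ w, g (reveal q w l (posterior q p) x) ∂ω
          + (if b then 0 else weight (σ p)) * f (Function.update x a false, false) := by
      intro x b
      have hm : Measurable fun w => f (reveal q w (a :: l) p (Function.update x a b)) :=
        hf.comp (hmeas _ _ _)
      rw [lintegral_infinitePi_update _ (some (false, a)) hm, ← hH]
      have this := fun (w : Option (Bool × V) → I) (c : I) =>
        reveal_cons_update q w hal p x b c (w (some (true, a)))
      simp only [Function.update_eq_self] at this
      simp only [this]
      have h2 := fun w : Option (Bool × V) → I => lintegral_decide_le p fun c => f (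
        if b || c then
          (Function.update (reveal q w l (posterior q p) x).1 a
            (!(reveal q w l (posterior q p) x).2 || decide (w (some (true, a)) ≤ q)),
            (reveal q w l (posterior q p) x).2)
        else (Function.update x a b, false))
      simp only [h2]
      cases b
      · simp only [Bool.or_true, if_true, Bool.or_false, Bool.false_eq_true, if_false]
        rw [lintegral_add_right _ measurable_const, lintegral_const_mul']
        · simp [ω]
        · simp [weight]
      · simp only [Bool.true_or, if_true, zero_mul, one_mul, add_zero, ← add_mul,
          weight_add_weight_symm]
        rfl
    have hF : Measurable fun x => ∫⁻ w, f (reveal q w (a :: l) p x) ∂ω :=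
      (hf.comp (measurable_reveal q (a :: l) p)).lintegral_prod_right'
    have hG : Measurable fun x => ∫⁻ w, g (reveal q w l (posterior q p) x) ∂ω :=
      (hgm.comp (measurable_reveal q l _)).lintegral_prod_right'
    have hR : Measurable fun x => weight p * f (x, true) + weight (σ p) * f (x, false) :=
      ((hf.comp measurable_prodMk_right).const_mul _).add
        ((hf.comp measurable_prodMk_right).const_mul _)
    rw [lintegral_infinitePi_bernoulli q a hF, lintegral_infinitePi_bernoulli q a hR]
    simp only [key, if_true, Bool.false_eq_true, if_false, zero_mul, one_mul, add_zero]
    have h1 : ∀ x : V → Bool, weight q * ∫⁻ w, g (reveal q w l (posterior q p) x) ∂ω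
          + weight (σ q) * (weight p * ∫⁻ w, g (reveal q w l (posterior q p) x) ∂ω
            + weight (σ p) * f (Function.update x a false, false))
        = (weight q + weight (σ q) * weight p) * ∫⁻ w, g (reveal q w l (posterior q p) x) ∂ω
          + weight (σ q) * weight (σ p) * f (Function.update x a false, false) := fun x => by ring
    simp only [h1]
    rw [lintegral_add_left (hG.const_mul _), lintegral_const_mul _ hG, ih hl (posterior q p) hgm,
      ← lintegral_const_mul, ← lintegral_add_left]
    · refine lintegral_congr fun x => ?_
      simp only [hg, Bool.not_true, Bool.false_or, Bool.not_false, Bool.true_or, ← add_mul,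
        weight_add_weight_symm, one_mul]
      -- Passing and selected has mass p; passing and rejected has mass q(1-p), with the head
      -- occupied. Stopping at the head supplies the missing (1-q)(1-p), with the head empty.
      rw [mul_add, ← mul_assoc, ← mul_assoc, weight_posterior hq, weight_symm_posterior hq]
      ring
    · exact ((hgm.comp measurable_prodMk_right).const_mul _ |>.add
        ((hgm.comp measurable_prodMk_right).const_mul _)).const_mul _
    · exact (hgm.comp measurable_prodMk_right).const_mul _ |>.add
        ((hgm.comp measurable_prodMk_right).const_mul _)

/-! ### The equivariant, local scheme of simultaneous revelations -/

section Stages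

variable {V : Type*} [AddCommGroup V] [DecidableEq V]

/-- The translate `A + v`. -/
def translate (A : Finset V) (v : V) : Finset V := A.map (addRightEmbedding v)

omit [DecidableEq V] in
theorem mem_translate {A : Finset V} {v z : V} : z ∈ translate A v ↔ z - v ∈ A := by
  simp only [translate, Finset.mem_map, addRightEmbedding_apply]
  exact ⟨by rintro ⟨a, ha, rfl⟩; simpa, fun h => ⟨_, h, by simp⟩⟩

omit [DecidableEq V] in
theorem translate_translate (A : Finset V) (v w : V) :
    translate (translate A v) w = translate A (v + w) := by
  ext z
  rw [mem_translate, mem_translate, mem_translate, sub_sub, add_comm w v]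

omit [DecidableEq V] in
@[simp] theorem translate_zero (A : Finset V) : translate A 0 = A := by
  ext z
  rw [mem_translate, sub_zero]

omit [DecidableEq V] in
@[simp] theorem card_translate (A : Finset V) (v : V) : (translate A v).card = A.card :=
  Finset.card_map _

/-- Labels of the uniform random variables attached to a site. -/
abbrev Label (V : Type*) := (Bool × Finset V) ⊕ Finset V ⊕ Option ℕ

/-- The input of the factor map: uniform random variables indexed by sites and labels. -/
abbrev Input (V : Type*) := V × Label V → I

/-- The law of the input. -/
noncomputable abbrev inputLaw (V : Type*) : Measure (Input V) :=
  Measure.infinitePi fun _ : V × Label V => (volume : Measure I)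

/-- The indices of the random variables used to reveal the set `A + v`. -/
def revealIndex (A : Finset V) (v : V) : Option (Bool × V) → V × Label V
  | none => (v, .inr (.inl A))
  -- The set is recorded as seen from the site a, so a translation of the input moves only the site
  -- index.
  | some (b, a) => (a, .inl (b, translate A (v - a)))

-- Different sets use disjoint families of coins; this gives independence between revelations.
omit [DecidableEq V] in
theorem translate_eq_of_revealIndex_eq {A A' : Finset V} {v v' : V} {i j : Option (Bool × V)}
    (h : revealIndex A v i = revealIndex A' v' j) : translate A v = translate A' v' := by
  rcases i with _ | ⟨b, a⟩ <;> rcases j with _ | ⟨b', a'⟩ <;>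
    simp only [revealIndex, Prod.mk.injEq, Sum.inr.injEq, Sum.inl.injEq, reduceCtorEq,
      and_false] at h
  · rw [h.1, h.2]
  · obtain ⟨rfl, -, h⟩ := h
    have := congrArg (translate · a) h
    simpa [translate_translate] using this

omit [DecidableEq V] in
theorem revealIndex_injective (A : Finset V) (v : V) : Function.Injective (revealIndex A v) := by
  intro i j h
  rcases i with _ | ⟨b, a⟩ <;> rcases j with _ | ⟨b', a'⟩ <;>
    simp only [revealIndex, Prod.mk.injEq, Sum.inl.injEq, reduceCtorEq, and_false] at h
  · rfl
  · rw [h.1, h.2.1]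

/-- Reveal the set `A + v`. The first component of the state is the configuration of the
singletons that is still fresh, the second one is the union of the sets selected so far. -/
noncomputable def step (q : I) (p : Finset V → I) (A : Finset V) (v : V) (s : V → Bool × Bool)
    (w : Option (Bool × V) → I) : V → Bool × Bool :=
  let y := reveal q w (A.toList.map (· + v)) (p (translate A v)) fun z => (s z).1
  fun z => (y.1 z, (s z).2 || (y.2 && decide (z ∈ translate A v)))

omit [DecidableEq V] in
theorem mem_map_toList {A : Finset V} {v z : V} :
    z ∈ A.toList.map (· + v) ↔ z ∈ translate A v := by
  simp [translate]

theorem step_of_notMem {q : I} {p : Finset V → I} {A : Finset V} {v z : V} (s : V → Bool × Bool)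
    (w : Option (Bool × V) → I) (hz : z ∉ translate A v) : step q p A v s w z = s z := by
  simp only [step, hz, decide_false, Bool.and_false, Bool.or_false]
  rw [reveal_fst_of_notMem _ _ _ _ _ (mt mem_map_toList.1 hz)]

theorem step_congr {q : I} {p : Finset V → I} {A : Finset V} {v : V} {s s' : V → Bool × Bool}
    {w w' : Option (Bool × V) → I} (hs : ∀ z ∈ translate A v, s z = s' z)
    (h0 : w none = w' none) (hw : ∀ a ∈ translate A v, ∀ b, w (some (b, a)) = w' (some (b, a)))
    {z : V} (hz : s z = s' z) :
    step q p A v s w z = step q p A v s' w' z := by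
  obtain ⟨h2, h1⟩ := reveal_congr_config q w (A.toList.map (· + v)) (p (translate A v))
    (x := fun z => (s z).1) (x' := fun z => (s' z).1) fun a ha => by
      rw [hs a (mem_map_toList.1 ha)]
  simp only [step]
  rw [h2, h1 z (by rw [hz]), hz,
    reveal_congr q _ _ _ h0 fun a ha b => hw a (mem_map_toList.1 ha) b]

theorem step_or_of_lt {q : I} (hq : 0 < (q : ℝ)) (p : Finset V → I) (A : Finset V) (v z : V)
    (s : V → Bool × Bool) (w : Option (Bool × V) → I)
    (h : (p (translate A v) : ℝ) * ((q : ℝ)⁻¹) ^ A.card < w (some (false, z))) :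
    ((step q p A v s w z).1 || (step q p A v s w z).2) = ((s z).1 || (s z).2) := by
  have := reveal_or_of_lt hq w (A.toList.map (· + v)) (p (translate A v)) (fun z => (s z).1) z
    (by simpa using h)
  simp only [step]
  rw [← this]
  simp only [mem_map_toList]
  generalize (s z).2 = b
  generalize (reveal q w _ _ _).1 z = b1
  generalize (reveal q w _ _ _).2 = b2
  generalize decide (z ∈ translate A v) = b3
  revert b b1 b2 b3
  decide

-- Sites enter the revelation only through equality, so it commutes with injective relabelling.
-- Applied to a translation, this gives `step_shift`.
omit [AddCommGroup V] in
theorem reveal_map (q : I) (w w' : Option (Bool × V) → I) (e : V → V)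
    (he : Function.Injective e) (h0 : w none = w' none)
    (hw : ∀ b a, w (some (b, e a)) = w' (some (b, a))) (l : List V) (p : I) (x x' : V → Bool)
    (hx : ∀ a, x (e a) = x' a) :
    (reveal q w (l.map e) p x).2 = (reveal q w' l p x').2 ∧
      ∀ a, (reveal q w (l.map e) p x).1 (e a) = (reveal q w' l p x').1 a := by
  induction l generalizing p with
  | nil => simp [reveal, h0, hx]
  | cons a l ih =>
    obtain ⟨h2, h1⟩ := ih (posterior q p)
    by_cases hc : (x' a || decide (w' (some (false, a)) ≤ p)) = true
    · simp only [List.map_cons, reveal, hw, hx, hc, if_true]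
      refine ⟨h2, fun a' => ?_⟩
      by_cases haa : a' = a
      · subst haa; simp [h2]
      · rw [Function.update_of_ne (he.ne haa), Function.update_of_ne haa, h1]
    · simp only [List.map_cons, reveal, hw, hx, hc]
      exact ⟨rfl, hx⟩

/-- Translation of the input. -/
def shiftInput (w : V) (u : Input V) : Input V := fun i => u (i.1 - w, i.2)

theorem step_shift (q : I) {p : Finset V → I}
    (hp : ∀ (A : Finset V) (v : V), A.Nonempty → p (translate A v) = p A)
    {A : Finset V} (hA : A.Nonempty) (v t : V) (s : V → Bool × Bool) (u : Input V) (z : V) :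
    step q p A v (fun z => s (z - t)) (fun i => shiftInput t u (revealIndex A v i)) z
      = step q p A (v - t) s (fun i => u (revealIndex A (v - t) i)) (z - t) := by
  obtain ⟨h2, h1⟩ := reveal_map q (fun i => shiftInput t u (revealIndex A v i))
    (fun i => u (revealIndex A (v - t) i)) (· + t) (add_left_injective t)
    (by simp [shiftInput, revealIndex])
    (by intro b a; simp [shiftInput, revealIndex, sub_sub, add_comm])
    (A.toList.map (· + (v - t))) (p A) (fun z => (s (z - t)).1) (fun z => (s z).1) (by simp)
  have hl : (A.toList.map (· + (v - t))).map (· + t) = A.toList.map (· + v) := by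
    simp [List.map_map, Function.comp_def, add_assoc]
  rw [hl] at h1 h2
  have h1 := h1 (z - t)
  simp only [sub_add_cancel] at h1
  simp only [step, hp A _ hA, h1, h2, mem_translate, sub_sub_sub_cancel_right]

variable (q : I) (p : Finset V → I) (𝒜 : ℕ → Finset V)

/-- The number `1/2` in the unit interval. -/
noncomputable def half : I := ⟨1 / 2, by norm_num, by norm_num⟩

/-- `v` is chosen at time `n`; the translates of `𝒜 n` by the chosen points are disjoint. -/
def IsCenter (n : ℕ) (u : Input V) (v : V) : Prop :=
  u (v, .inr (.inr (some n))) ≤ half ∧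
    ∀ a ∈ 𝒜 n, ∀ b ∈ 𝒜 n, a ≠ b → ¬ u (v + a - b, .inr (.inr (some n))) ≤ half

/-- The set `B` has been revealed before time `n`; sets with at most one element are never
revealed. -/
def Treated : ℕ → Input V → Finset V → Prop
  | 0, _, B => B.card ≤ 1
  | n + 1, u, B => Treated n u B ∨ ∃ v, IsCenter 𝒜 n u v ∧ B = translate (𝒜 n) v

/-- The set `𝒜 n + v` is revealed at time `n`. -/
def IsActive (n : ℕ) (u : Input V) (v : V) : Prop :=
  IsCenter 𝒜 n u v ∧ ¬ Treated 𝒜 n u (translate (𝒜 n) v)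

open Classical in
/-- The state at time `n`. -/
noncomputable def stage : ℕ → Input V → V → Bool × Bool
  | 0, u, z => (decide (u (z, .inr (.inr none)) ≤ q), false)
  | n + 1, u, z =>
    -- At most one such v exists by `IsCenter.eq`, so the choice is canonical and equivariance
    -- survives.
    if h : ∃ v, IsActive 𝒜 n u v ∧ z ∈ translate (𝒜 n) v then
      step q p (𝒜 n) h.choose (stage n u) (fun i => u (revealIndex (𝒜 n) h.choose i)) z
    else stage n u z

variable {q p 𝒜}

-- If z = a + v = b + v' with a, b in `𝒜 n`, then v' = v + a - b, which the centre condition at v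
-- excludes unless a = b.
omit [DecidableEq V] in
theorem IsCenter.eq {n : ℕ} {u : Input V} {v v' z : V} (h : IsCenter 𝒜 n u v)
    (h' : IsCenter 𝒜 n u v') (hz : z ∈ translate (𝒜 n) v) (hz' : z ∈ translate (𝒜 n) v') :
    v = v' := by
  by_contra hne
  rw [mem_translate] at hz hz'
  refine h.2 _ hz _ hz' (fun h => hne ?_) ?_
  · exact sub_right_injective h
  · have : v + (z - v) - (z - v') = v' := by abel
    rw [this]
    exact h'.1

theorem stage_succ_of_active {n : ℕ} {u : Input V} {v z : V} (h : IsActive 𝒜 n u v)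
    (hz : z ∈ translate (𝒜 n) v) :
    stage q p 𝒜 (n + 1) u z
      = step q p (𝒜 n) v (stage q p 𝒜 n u) (fun i => u (revealIndex (𝒜 n) v i)) z := by
  have hex : ∃ v, IsActive 𝒜 n u v ∧ z ∈ translate (𝒜 n) v := ⟨v, h, hz⟩
  have : hex.choose = v := hex.choose_spec.1.1.eq h.1 hex.choose_spec.2 hz
  rw [stage, dif_pos hex, this]

theorem stage_succ_of_not {n : ℕ} {u : Input V} {z : V}
    (h : ∀ v, IsActive 𝒜 n u v → z ∉ translate (𝒜 n) v) :
    stage q p 𝒜 (n + 1) u z = stage q p 𝒜 n u z := by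
  rw [stage, dif_neg]
  rintro ⟨v, h1, h2⟩
  exact h v h1 h2

omit [DecidableEq V] in
theorem Treated.mono {u : Input V} {B : Finset V} {n m : ℕ} (hnm : n ≤ m)
    (h : Treated 𝒜 n u B) : Treated 𝒜 m u B := by
  induction m, hnm using Nat.le_induction with
  | base => exact h
  | succ m _ ih => exact .inl ih

omit [DecidableEq V] in
theorem IsActive.nonempty {n : ℕ} {u : Input V} {v : V} (h : IsActive 𝒜 n u v) :
    (𝒜 n).Nonempty := by
  by_contra hne
  rw [Finset.not_nonempty_iff_eq_empty] at hne
  refine h.2 (Treated.mono (Nat.zero_le n) ?_)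
  simp [Treated, hne]

omit [DecidableEq V] in
theorem isCenter_shift (n : ℕ) (u : Input V) (v t : V) :
    IsCenter 𝒜 n (shiftInput t u) v ↔ IsCenter 𝒜 n u (v - t) := by
  have : ∀ a b : V, v + a - b - t = v - t + a - b := fun a b => by abel
  simp only [IsCenter, shiftInput, this]

omit [DecidableEq V] in
theorem treated_shift (n : ℕ) (u : Input V) (B : Finset V) (t : V) :
    Treated 𝒜 n (shiftInput t u) B ↔ Treated 𝒜 n u (translate B (-t)) := by
  induction n with
  | zero => simp [Treated]
  | succ n ih =>
    rw [Treated, Treated, ih]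
    refine or_congr Iff.rfl ⟨?_, ?_⟩
    · rintro ⟨v, hv, rfl⟩
      exact ⟨v - t, (isCenter_shift n u v t).1 hv, by rw [translate_translate, sub_eq_add_neg]⟩
    · rintro ⟨v, hv, h⟩
      refine ⟨v + t, (isCenter_shift n u _ t).2 (by simpa using hv), ?_⟩
      rw [← translate_translate, ← h, translate_translate, neg_add_cancel, translate_zero]

omit [DecidableEq V] in
theorem isActive_shift (n : ℕ) (u : Input V) (v t : V) :
    IsActive 𝒜 n (shiftInput t u) v ↔ IsActive 𝒜 n u (v - t) := by
  rw [IsActive, IsActive, isCenter_shift, treated_shift, translate_translate, sub_eq_add_neg]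

theorem stage_shift (hp : ∀ (A : Finset V) (v : V), A.Nonempty → p (translate A v) = p A)
    (n : ℕ) (u : Input V) (t z : V) :
    stage q p 𝒜 n (shiftInput t u) z = stage q p 𝒜 n u (z - t) := by
  induction n generalizing z with
  | zero => rfl
  | succ n ih =>
    by_cases h : ∃ v, IsActive 𝒜 n (shiftInput t u) v ∧ z ∈ translate (𝒜 n) v
    · obtain ⟨v, hv, hz⟩ := h
      rw [stage_succ_of_active hv hz, stage_succ_of_active ((isActive_shift n u v t).1 hv)
        (by rw [mem_translate] at hz ⊢; simpa using hz), ← step_shift q hp hv.nonempty]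
      congr 1
      ext1 z
      exact ih z
    · push Not at h
      rw [stage_succ_of_not h, stage_succ_of_not, ih]
      intro v hv hz
      refine h (v + t) ((isActive_shift n u _ t).2 (by simpa using hv)) ?_
      rw [mem_translate] at hz ⊢
      rwa [show z - (v + t) = z - t - v by abel]

theorem measurable_step (A : Finset V) (v : V) :
    Measurable fun z : (V → Bool × Bool) × (Option (Bool × V) → I) => step q p A v z.1 z.2 := by
  have hx : Measurable fun z : (V → Bool × Bool) × (Option (Bool × V) → I) =>
      ((fun v => (z.1 v).1 : V → Bool), z.2) := by fun_prop
  have hr := (measurable_reveal q (A.toList.map (· + v)) (p (translate A v))).comp hx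
  refine measurable_pi_iff.2 fun z => ?_
  refine (measurable_pi_iff.1 hr.fst z).prodMk ?_
  have h2 : Measurable fun z' : (V → Bool × Bool) × (Option (Bool × V) → I) => (z'.1 z).2 := by
    fun_prop
  exact (measurable_of_finite fun y : Bool × Bool =>
    y.1 || (y.2 && decide (z ∈ translate A v))).comp (h2.prodMk hr.snd)

omit [DecidableEq V] in
theorem measurableSet_isCenter (n : ℕ) (v : V) : MeasurableSet {u : Input V | IsCenter 𝒜 n u v} := by
  have h : ∀ z : V, MeasurableSet {u : Input V | u (z, .inr (.inr (some n))) ≤ half} := fun z =>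
    measurableSet_le (measurable_pi_apply _) measurable_const
  have : {u : Input V | IsCenter 𝒜 n u v} = {u | u (v, .inr (.inr (some n))) ≤ half} ∩
      ⋂ a ∈ 𝒜 n, ⋂ b ∈ 𝒜 n, ⋂ (_ : a ≠ b), {u | u (v + a - b, .inr (.inr (some n))) ≤ half}ᶜ := by
    ext u
    simp [IsCenter]
  rw [this]
  exact (h v).inter (Finset.measurableSet_biInter _ fun a _ => Finset.measurableSet_biInter _
    fun b _ => MeasurableSet.iInter fun _ => (h _).compl)

omit [DecidableEq V] in
theorem measurableSet_treated [Countable V] (n : ℕ) (B : Finset V) :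
    MeasurableSet {u : Input V | Treated 𝒜 n u B} := by
  induction n with
  | zero => simp [Treated]
  | succ n ih =>
    have : {u : Input V | Treated 𝒜 (n + 1) u B} = {u | Treated 𝒜 n u B} ∪
        ⋃ v : V, ⋃ (_ : B = translate (𝒜 n) v), {u | IsCenter 𝒜 n u v} := by
      ext u
      simp only [Treated, Set.mem_ofPred_eq, Set.mem_union, Set.mem_iUnion, exists_prop]
      simp only [and_comm]
    rw [this]
    exact ih.union (MeasurableSet.iUnion fun v => .iUnion fun _ => measurableSet_isCenter n v)

theorem measurable_stage [Countable V] (n : ℕ) : Measurable fun u : Input V => stage q p 𝒜 n u := by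
  induction n with
  | zero =>
    refine measurable_pi_iff.2 fun z => ?_
    have h : Measurable fun u : Input V => decide (u (z, .inr (.inr none)) ≤ q) :=
      (measurable_decide_le q).comp (measurable_pi_apply _)
    exact h.prodMk measurable_const
  | succ n ih =>
    refine measurable_pi_iff.2 fun z => measurable_to_countable' fun b => ?_
    have hact : ∀ v, MeasurableSet {u : Input V | IsActive 𝒜 n u v} := fun v =>
      (measurableSet_isCenter n v).inter (measurableSet_treated n _).compl
    have hst : ∀ v, Measurable fun u : Input V => step q p (𝒜 n) v (stage q p 𝒜 n u)
        (fun i => u (revealIndex (𝒜 n) v i)) := fun v =>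
      (measurable_step (𝒜 n) v).comp (ih.prodMk (by fun_prop))
    have : (fun u : Input V => stage q p 𝒜 (n + 1) u z) ⁻¹' {b}
        = (⋃ v : V, ⋃ (_ : z ∈ translate (𝒜 n) v), {u | IsActive 𝒜 n u v} ∩
            {u | step q p (𝒜 n) v (stage q p 𝒜 n u)
              (fun i => u (revealIndex (𝒜 n) v i)) z = b}) ∪
          ((⋂ v : V, ⋂ (_ : z ∈ translate (𝒜 n) v), {u | IsActive 𝒜 n u v}ᶜ) ∩
            {u | stage q p 𝒜 n u z = b}) := by
      ext u
      simp only [Set.mem_preimage, Set.mem_singleton_iff, Set.mem_union, Set.mem_iUnion,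
        Set.mem_inter_iff, Set.mem_ofPred_eq, Set.mem_iInter, Set.mem_compl_iff]
      by_cases h : ∃ v, IsActive 𝒜 n u v ∧ z ∈ translate (𝒜 n) v
      · obtain ⟨v, hv, hz⟩ := h
        rw [stage_succ_of_active hv hz]
        constructor
        · intro h
          exact .inl ⟨v, hz, hv, h⟩
        · rintro (⟨v', hz', hv', h⟩ | ⟨h, -⟩)
          · rwa [hv.1.eq hv'.1 hz hz']
          · exact absurd hv (h v hz)
      · push Not at h
        rw [stage_succ_of_not h]
        constructor
        · exact fun hb => .inr ⟨fun v hz hv => h v hv hz, hb⟩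
        · rintro (⟨v', hz', hv', -⟩ | ⟨-, hb⟩)
          · exact absurd hz' (h v' hv')
          · exact hb
    rw [this]
    refine .union (.iUnion fun v => .iUnion fun _ => (hact v).inter ?_)
      (.inter (.iInter fun v => .iInter fun _ => (hact v).compl) ?_)
    · exact (measurable_pi_iff.1 (hst v) z) (measurableSet_singleton b)
    · exact (measurable_pi_iff.1 ih z) (measurableSet_singleton b)

/-- At time `n` the state near a given site depends on the input near that site only. -/
theorem exists_dependence (n : ℕ) (K : Finset V) :
    ∃ K' : Finset V, ∀ u u' : Input V, (∀ z ∈ K', ∀ l, u (z, l) = u' (z, l)) →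
      (∀ B, (∃ z ∈ K, z ∈ B) → (Treated 𝒜 n u B ↔ Treated 𝒜 n u' B)) ∧
      ∀ z ∈ K, stage q p 𝒜 n u z = stage q p 𝒜 n u' z := by
  induction n generalizing K with
  | zero => exact ⟨K, fun u u' h => ⟨fun B _ => Iff.rfl, fun z hz => by simp [stage, h z hz]⟩⟩
  | succ n ih =>
    -- C contains every possible centre of a translate meeting K. Deciding whether these are centres
    -- reads the sites in N; revealing their translates needs the earlier state on `K1`.
    set C : Finset V := (K ×ˢ 𝒜 n).image fun x => x.1 - x.2 with hC
    have hCmem : ∀ z ∈ K, ∀ v, z ∈ translate (𝒜 n) v → v ∈ C := fun z hz v hv =>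
      Finset.mem_image.2 ⟨(z, z - v), by simp [hz, mem_translate.1 hv], by simp⟩
    set K1 : Finset V := K ∪ C.biUnion (translate (𝒜 n)) with hK1
    obtain ⟨K', hK'⟩ := ih K1
    set N : Finset V := (C ×ˢ 𝒜 n ×ˢ 𝒜 n).image fun x => x.1 + x.2.1 - x.2.2 with hN
    refine ⟨K' ∪ K1 ∪ C ∪ N, fun u u' h => ?_⟩
    obtain ⟨h1, h2⟩ := hK' u u' fun z hz => h z (by simp [hz])
    have hcen : ∀ v ∈ C, IsCenter 𝒜 n u v ↔ IsCenter 𝒜 n u' v := by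
      intro v hv
      have e : ∀ a ∈ 𝒜 n, ∀ b ∈ 𝒜 n, ∀ l, u (v + a - b, l) = u' (v + a - b, l) :=
        fun a ha b hb l => h _ (Finset.mem_union_right _
          (Finset.mem_image.2 ⟨(v, a, b), by simp [hv, ha, hb], rfl⟩)) l
      rw [IsCenter, IsCenter, h v (by simp [hv])]
      refine and_congr Iff.rfl ⟨fun H a ha b hb => ?_, fun H a ha b hb => ?_⟩
      · rw [← e a ha b hb]; exact H a ha b hb
      · rw [e a ha b hb]; exact H a ha b hb
    have hact : ∀ z ∈ K, ∀ v, z ∈ translate (𝒜 n) v →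
        (IsActive 𝒜 n u v ↔ IsActive 𝒜 n u' v) := by
      intro z hz v hv
      rw [IsActive, IsActive, hcen v (hCmem z hz v hv), h1 _ ⟨z, by simp [hK1, hz], hv⟩]
    refine ⟨fun B hB => ?_, fun z hz => ?_⟩
    · obtain ⟨z, hz, hzB⟩ := hB
      rw [Treated, Treated, h1 B ⟨z, by simp [hK1, hz], hzB⟩]
      refine or_congr Iff.rfl (exists_congr fun v => ?_)
      refine and_congr_left fun hv => hcen v (hCmem z hz v (hv ▸ hzB))
    · by_cases hv : ∃ v, IsActive 𝒜 n u v ∧ z ∈ translate (𝒜 n) v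
      · obtain ⟨v, hv, hzv⟩ := hv
        have hvC := hCmem z hz v hzv
        have hsub : ∀ a ∈ translate (𝒜 n) v, a ∈ K1 := fun a ha =>
          Finset.mem_union_right _ (Finset.mem_biUnion.2 ⟨v, hvC, ha⟩)
        rw [stage_succ_of_active hv hzv, stage_succ_of_active ((hact z hz v hzv).1 hv) hzv]
        refine step_congr (fun a ha => h2 a (hsub a ha)) (h v (by simp [hvC]) _)
          (fun a ha b => h a ?_ _) (h2 z (hsub z hzv))
        simp [hsub a ha]
      · push Not at hv
        rw [stage_succ_of_not hv, stage_succ_of_not fun v hv' hz' => hv v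
          ((hact z hz v hz').2 hv') hz', h2 z (by simp [hK1, hz])]

end Stages

/-! ### The law produced by finitely many successive revelations -/

section Sequential

variable {V : Type*} [AddCommGroup V] [DecidableEq V] {q : I} {p : Finset V → I}

variable (q p) in
/-- The state after revealing the sets of a list one after the other, starting from the end. -/
noncomputable def sequential : List (Finset V × V) → Input V → V → Bool × Bool
  | [], u => fun z => (decide (u (z, .inr (.inr none)) ≤ q), false)
  | x :: ℓ, u => step q p x.1 x.2 (sequential ℓ u) fun i => u (revealIndex x.1 x.2 i)

variable (p) in
/-- The average of `h` over the union of independently selected sets of a list. -/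
noncomputable def unionAverage : List (Finset V × V) → ((V → Bool) → ENNReal) → ENNReal
  | [], h => h fun _ => false
  | x :: ℓ, h => unionAverage ℓ fun y =>
      weight (p (translate x.1 x.2)) * h (fun z => y z || decide (z ∈ translate x.1 x.2))
        + weight (σ (p (translate x.1 x.2))) * h y

theorem measurable_sequential (ℓ : List (Finset V × V)) : Measurable (sequential q p ℓ) := by
  induction ℓ with
  | nil =>
    refine measurable_pi_iff.2 fun z => ?_
    have h : Measurable fun u : Input V => decide (u (z, .inr (.inr none)) ≤ q) :=
      (measurable_decide_le q).comp (measurable_pi_apply _)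
    exact h.prodMk measurable_const
  | cons x ℓ ih => exact (measurable_step x.1 x.2).comp (ih.prodMk (by fun_prop))

theorem sequential_congr (ℓ : List (Finset V × V)) {u u' : Input V}
    (h0 : ∀ z, u (z, .inr (.inr none)) = u' (z, .inr (.inr none)))
    (h : ∀ x ∈ ℓ, ∀ i, u (revealIndex x.1 x.2 i) = u' (revealIndex x.1 x.2 i)) :
    sequential q p ℓ u = sequential q p ℓ u' := by
  induction ℓ with
  | nil => simp [sequential, h0]
  | cons x ℓ ih =>
    simp only [sequential, ih fun y hy => h y (by simp [hy]), h x (by simp)]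

omit [AddCommGroup V] [DecidableEq V] in
theorem infinitePi_bernoulli_eq_map (q : I) :
    (Measure.infinitePi fun _ : V => bernoulliMeasure true false q)
      = (inputLaw V).map fun u z => decide (u (z, .inr (.inr none)) ≤ q) := by
  have h1 := Measure.map_infinitePi_infinitePi_of_inj
    (P := fun _ : V × Label V => (volume : Measure I)) (α := V)
    (f := fun z : V => ((z, .inr (.inr none)) : V × Label V)) (fun a b h => (Prod.mk.inj h).1)
  have h2 := Measure.infinitePi_map_pi (fun _ : V => (volume : Measure I))
    (f := fun _ x => decide (x ≤ q)) (fun _ => measurable_decide_le q)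
  simp only [map_decide_le_volume] at h2
  rw [← h2, ← h1, Measure.map_map _ (by fun_prop)]
  · rfl
  · exact measurable_pi_iff.2 fun z => (measurable_decide_le q).comp (measurable_pi_apply z)

/-- After each revelation the field is a fresh Bernoulli(q) field, independent of the union so far,
so the next set can be revealed from it. Distinctness of the sets guarantees unused coins. -/
theorem lintegral_sequential (hq : 0 < (q : ℝ)) (ℓ : List (Finset V × V))
    (hℓ : (ℓ.map fun x => translate x.1 x.2).Nodup) {f : (V → Bool × Bool) → ENNReal}
    (hf : Measurable f) :
    ∫⁻ u, f (sequential q p ℓ u) ∂(inputLaw V)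
      = unionAverage p ℓ fun y => ∫⁻ x, f (fun z => (x z, y z))
        ∂(Measure.infinitePi fun _ : V => bernoulliMeasure true false q) := by
  classical
  induction ℓ generalizing f with
  | nil =>
    simp only [unionAverage]
    rw [infinitePi_bernoulli_eq_map, lintegral_map]
    · rfl
    · exact hf.comp (measurable_pi_iff.2 fun z =>
        (measurable_pi_apply z).prodMk measurable_const)
    · exact measurable_pi_iff.2 fun z => (measurable_decide_le q).comp (measurable_pi_apply _)
  | cons x ℓ ih =>
    obtain ⟨A, v⟩ := x
    simp only [List.map_cons, List.nodup_cons] at hℓ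
    obtain ⟨hx, hℓ⟩ := hℓ
    set ω := Measure.infinitePi fun _ : Option (Bool × V) => (volume : Measure I) with hω
    have hF : Measurable fun u => f (sequential q p ((A, v) :: ℓ) u) :=
      hf.comp (measurable_sequential _)
    have hωmap : (inputLaw V).map (fun u i => u (revealIndex A v i)) = ω :=
      Measure.map_infinitePi_infinitePi_of_inj
        (P := fun _ : V × Label V => (volume : Measure I)) (revealIndex_injective A v)
    have hstep : Measurable fun z : (V → Bool × Bool) × (Option (Bool × V) → I) =>
      f (step q p A v z.1 z.2) := hf.comp (measurable_step A v)
    -- The earlier revelations read only J, the coins of the last one lie outside J; take the two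
    -- from independent copies.
    obtain ⟨J, hJ⟩ : ∃ J, J = (Set.range (revealIndex A v))ᶜ := ⟨_, rfl⟩
    rw [lintegral_infinitePi_piecewise _ J hF]
    have h1 : ∀ u w : Input V, sequential q p ((A, v) :: ℓ)
        (J.piecewise u w)
        = step q p A v (sequential q p ℓ u) fun i => w (revealIndex A v i) := by
      intro u w
      simp only [sequential]
      rw [sequential_congr (u' := u) ℓ]
      · congr 1
        ext1 i
        exact Set.piecewise_eq_of_notMem _ _ _ (by simp [hJ])
      · intro z
        refine Set.piecewise_eq_of_mem _ _ _ ?_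
        rw [hJ]
        rintro ⟨i, hi⟩
        rcases i with _ | i <;> simp [revealIndex] at hi
      · intro y hy i
        refine Set.piecewise_eq_of_mem _ _ _ ?_
        rw [hJ]
        rintro ⟨j, hj⟩
        exact hx (List.mem_map.2 ⟨y, hy, (translate_eq_of_revealIndex_eq hj).symm⟩)
    simp only [h1]
    have h2 : ∀ s, ∫⁻ w, f (step q p A v s fun i => w (revealIndex A v i)) ∂(inputLaw V)
        = ∫⁻ w, f (step q p A v s w) ∂ω := by
      intro s
      rw [← hωmap, lintegral_map]
      · exact hstep.comp measurable_prodMk_left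
      · fun_prop
    simp only [h2]
    rw [ih hℓ (f := fun s => ∫⁻ w, f (step q p A v s w) ∂ω) hstep.lintegral_prod_right']
    simp only [unionAverage]
    congr 1
    ext1 y
    have hpair : ∀ y' : V → Bool,
        Measurable fun x : V → Bool => f fun z => (x z, y' z) := fun y' =>
      hf.comp (measurable_pi_iff.2 fun z => (measurable_pi_apply z).prodMk measurable_const)
    have h3 := lintegral_reveal hq (A.toList.map (· + v))
      (A.nodup_toList.map (add_left_injective v)) (p (translate A v))
      (f := fun r => f fun z => (r.1 z, y z || (r.2 && decide (z ∈ translate A v))))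
      (hf.comp (measurable_pi_iff.2 fun z => ((measurable_pi_apply z).comp measurable_fst).prodMk
        ((measurable_of_finite fun b => y z || (b && decide (z ∈ translate A v))).comp
          measurable_snd)))
    refine h3.trans ?_
    simp only [Bool.true_and, Bool.false_and, Bool.or_false]
    rw [lintegral_add_left ((hpair _).const_mul _), lintegral_const_mul _ (hpair _),
      lintegral_const_mul _ (hpair _)]

-- The constant c absorbs the rejection probability of each set meeting E as the list is peeled off.
open Classical in
theorem unionAverage_vanishing (E : Finset V) (c : ENNReal) (ℓ : List (Finset V × V)) :
    (unionAverage p ℓ fun y => if ∀ z ∈ E, y z = false then c else 0)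
      = c * ((ℓ.map fun x => translate x.1 x.2).map fun B =>
          if ∃ z ∈ E, z ∈ B then weight (σ (p B)) else 1).prod := by
  induction ℓ generalizing c with
  | nil => simp [unionAverage]
  | cons x ℓ ih =>
    simp only [unionAverage, List.map_cons, List.prod_cons]
    by_cases hE : ∃ z ∈ E, z ∈ translate x.1 x.2
    · have h1 : ∀ y : V → Bool,
          ¬ ∀ z ∈ E, (y z || decide (z ∈ translate x.1 x.2)) = false := by
        intro y h
        obtain ⟨z, hz, hzB⟩ := hE
        simpa [hzB] using h z hz
      simp only [h1, if_false, mul_zero, zero_add, mul_ite, hE, if_true]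
      rw [ih]
      ring
    · have h1 : ∀ y : V → Bool, (∀ z ∈ E, (y z || decide (z ∈ translate x.1 x.2)) = false) ↔
          ∀ z ∈ E, y z = false := by
        intro y
        refine forall₂_congr fun z hz => ?_
        have : z ∉ translate x.1 x.2 := fun h => hE ⟨z, hz, h⟩
        simp [this]
      simp only [h1, ← add_mul, weight_add_weight_symm, one_mul, hE, if_false]
      exact ih c

theorem bernoulliMeasure_false (p : I) :
    bernoulliMeasure true false p {false} = weight (σ p) := by
  rw [bernoulliMeasure_apply_of_notMem_of_mem _ (measurableSet_singleton _) (by simp) (by simp),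
    coe_toNNReal_eq_weight]

omit [AddCommGroup V] [DecidableEq V] in
theorem infinitePi_bernoulli_vanishing (q : I) (E : Finset V) :
    (Measure.infinitePi fun _ : V => bernoulliMeasure true false q) (vanishing E)
      = weight (σ q) ^ E.card := by
  have : vanishing E = Set.pi E fun _ => {false} := by ext; simp [vanishing]
  rw [this, Measure.infinitePi_pi _ fun _ _ => measurableSet_singleton _]
  simp only [bernoulliMeasure_false, Finset.prod_const]

/-- The configurations of states in which no site of `E` is occupied. -/
def emptyOn (E : Finset V) : Set (V → Bool × Bool) :=
  {s | ∀ z ∈ E, ((s z).1 || (s z).2) = false}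

omit [AddCommGroup V] [DecidableEq V] in
theorem measurableSet_emptyOn (E : Finset V) : MeasurableSet (emptyOn E) := by
  have h : Measurable fun (s : V → Bool × Bool) z => (s z).1 || (s z).2 :=
    measurable_pi_iff.2 fun z => (measurable_of_finite fun b : Bool × Bool => b.1 || b.2).comp
      (measurable_pi_apply z)
  exact h (measurableSet_vanishing E)

omit [AddCommGroup V] in
theorem bernoulliFamily_noneSelected (hp1 : ∀ v, p {v} = q) (E : Finset V)
    (M : List (Finset V)) (hM : M.Nodup) (hM1 : ∀ B ∈ M, ¬ B.card ≤ 1) :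
    bernoulliFamily p (noneSelected {B | B.card ≤ 1 ∨ B ∈ M} E)
      = weight (σ q) ^ E.card * (M.map fun B => if ∃ z ∈ E, z ∈ B then weight (σ (p B)) else 1).prod := by
  classical
  set T : Finset (Finset V) := E.image (fun v => {v}) ∪
    M.toFinset.filter (fun B => ∃ z ∈ E, z ∈ B) with hT
  have hTne : ∀ B ∈ T, B.Nonempty := by
    intro B hB
    rcases Finset.mem_union.1 hB with h | h
    · obtain ⟨v, -, rfl⟩ := Finset.mem_image.1 h
      exact Finset.singleton_nonempty v
    · obtain ⟨-, z, -, hz⟩ := Finset.mem_filter.1 h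
      exact ⟨z, hz⟩
  have hset : noneSelected {B | B.card ≤ 1 ∨ B ∈ M} E
      = Set.pi (T.subtype Finset.Nonempty) fun _ => {false} := by
    ext X
    simp only [noneSelected, Set.mem_ofPred_eq, Set.mem_pi, Finset.mem_coe, Finset.mem_subtype,
      Set.mem_singleton_iff]
    refine forall_congr' fun A => ?_
    have : A.1 ∈ T ↔ (A.1.card ≤ 1 ∨ A.1 ∈ M) ∧ ∃ v ∈ E, v ∈ A.1 := by
      rw [hT, Finset.mem_union, Finset.mem_filter, List.mem_toFinset, or_and_right]
      refine or_congr ?_ Iff.rfl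
      rw [Finset.mem_image]
      constructor
      · rintro ⟨v, hv, h⟩
        rw [← h]
        exact ⟨by simp, v, hv, by simp⟩
      · rintro ⟨h, v, hv, hvA⟩
        refine ⟨v, hv, ?_⟩
        exact (Finset.eq_of_subset_of_card_le (by simpa using hvA) (by simpa using h))
    rw [this, and_imp]
  rw [hset, bernoulliFamily, Measure.infinitePi_pi _ fun _ _ => measurableSet_singleton _]
  simp only [bernoulliMeasure_false]
  rw [Finset.prod_subtype_of_mem (fun B => weight (σ (p B))) hTne, hT, Finset.prod_union,
    Finset.prod_image (by simp), ← List.prod_toFinset _ hM, Finset.prod_filter]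
  · simp [hp1]
  · rw [Finset.disjoint_left]
    intro B hB hB'
    obtain ⟨v, -, rfl⟩ := Finset.mem_image.1 hB
    exact hM1 _ (List.mem_toFinset.1 (Finset.mem_filter.1 hB').1) (by simp)

theorem inputLaw_sequential_emptyOn (hq : 0 < (q : ℝ)) (hp1 : ∀ v, p {v} = q)
    (ℓ : List (Finset V × V)) (hℓ : (ℓ.map fun x => translate x.1 x.2).Nodup)
    (hℓ1 : ∀ B ∈ ℓ.map fun x => translate x.1 x.2, ¬ B.card ≤ 1) (E : Finset V) :
    ∫⁻ u, (emptyOn E).indicator 1 (sequential q p ℓ u) ∂(inputLaw V)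
      = bernoulliFamily p
          (noneSelected {B | B.card ≤ 1 ∨ B ∈ ℓ.map fun x => translate x.1 x.2} E) := by
  classical
  rw [lintegral_sequential hq ℓ hℓ (measurable_one.indicator (measurableSet_emptyOn E)),
    bernoulliFamily_noneSelected hp1 E _ hℓ hℓ1, ← unionAverage_vanishing]
  congr 1
  ext1 y
  rw [← infinitePi_bernoulli_vanishing q E, ← lintegral_indicator_one (measurableSet_vanishing E)]
  split_ifs with h
  · refine lintegral_congr fun x => ?_
    have : ((fun z => (x z, y z)) ∈ emptyOn E) ↔ x ∈ vanishing E :=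
      forall₂_congr fun z hz => by simp [h z hz]
    simp [Set.indicator, this]
  · rw [lintegral_eq_zero_iff]
    · refine Filter.Eventually.of_forall fun x => ?_
      refine Set.indicator_of_notMem (fun hx => h fun z hz => ?_) _
      have := hx z hz
      simp only [Bool.or_eq_false_iff] at this
      exact this.2
    · exact (measurable_one.indicator (measurableSet_emptyOn E)).comp
        (measurable_pi_iff.2 fun z => (measurable_pi_apply z).prodMk measurable_const)

end Sequential

/-! ### The law of the state at a finite time -/

section StageLaw

variable {V : Type*} [AddCommGroup V] [DecidableEq V] {q : I} {p : Finset V → I}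
  {𝒜 : ℕ → Finset V}

/-- The translates by the points of `M` are disjoint, so that each of them is revealed as if the
others were absent. -/
theorem sequential_append (A : Finset V) (M : List V)
    (hM : M.Pairwise fun v v' => Disjoint (translate A v) (translate A v'))
    (ℓ : List (Finset V × V)) (u : Input V) (z : V) :
    (∀ v ∈ M, z ∈ translate A v → sequential q p (M.map (fun v => (A, v)) ++ ℓ) u z
        = step q p A v (sequential q p ℓ u) (fun i => u (revealIndex A v i)) z) ∧
      ((∀ v ∈ M, z ∉ translate A v) →
        sequential q p (M.map (fun v => (A, v)) ++ ℓ) u z = sequential q p ℓ u z) := by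
  induction M generalizing z with
  | nil => simp
  | cons w M ih =>
    rw [List.pairwise_cons] at hM
    have ih := fun z => ih hM.2 z
    simp only [List.map_cons, List.cons_append, sequential]
    constructor
    · intro v hv hz
      rcases List.mem_cons.1 hv with rfl | hv
      · have h : ∀ a ∈ translate A v, sequential q p (M.map (fun v => (A, v)) ++ ℓ) u a
            = sequential q p ℓ u a := fun a ha =>
          (ih a).2 fun v' hv' => Finset.disjoint_left.1 (hM.1 v' hv') ha
        exact step_congr h rfl (fun _ _ _ => rfl) (h z hz)
      · rw [step_of_notMem _ _ (Finset.disjoint_right.1 (hM.1 v hv) hz)]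
        exact (ih z).1 v hv hz
    · intro h
      rw [step_of_notMem _ _ (h w (by simp))]
      exact (ih z).2 fun v hv => h v (by simp [hv])

omit [DecidableEq V] in
theorem treated_congr {n : ℕ} {u u' : Input V}
    (h : ∀ z m, u (z, .inr (.inr (some m))) = u' (z, .inr (.inr (some m)))) (B : Finset V) :
    Treated 𝒜 n u B ↔ Treated 𝒜 n u' B := by
  induction n with
  | zero => rfl
  | succ n ih => simp only [Treated, ih, IsCenter, h]

omit [DecidableEq V] in
theorem isActive_congr {n : ℕ} {u u' : Input V}
    (h : ∀ z m, u (z, .inr (.inr (some m))) = u' (z, .inr (.inr (some m)))) (v : V) :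
    IsActive 𝒜 n u v ↔ IsActive 𝒜 n u' v := by
  rw [IsActive, IsActive, treated_congr h]
  simp only [IsCenter, h]

/-- On a finite set, the state at time `n` results from revealing finitely many sets one after
the other. -/
theorem exists_sequential (n : ℕ) (u : Input V) (K : Finset V) :
    ∃ ℓ : List (Finset V × V), (ℓ.map fun x => translate x.1 x.2).Nodup ∧
      (∀ B ∈ ℓ.map fun x => translate x.1 x.2, Treated 𝒜 n u B ∧ ¬ B.card ≤ 1) ∧
      (∀ B, Treated 𝒜 n u B → ¬ B.card ≤ 1 → (∃ z ∈ K, z ∈ B) →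
        B ∈ ℓ.map fun x => translate x.1 x.2) ∧
      ∀ u' : Input V, (∀ z m, u (z, .inr (.inr (some m))) = u' (z, .inr (.inr (some m)))) →
        ∀ z ∈ K, stage q p 𝒜 n u' z = sequential q p ℓ u' z := by
  classical
  induction n generalizing K with
  | zero =>
    refine ⟨[], by simp, by simp, fun B h h' => absurd h h', fun u' _ z _ => ?_⟩
    simp [stage, sequential]
  | succ n ih =>
    -- Only active translates meeting K matter. They are finitely many and disjoint, so revealing
    -- them in any order gives the simultaneous result.
    set C : Finset V := ((K ×ˢ 𝒜 n).image fun x => x.1 - x.2).filter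
      fun v => IsActive 𝒜 n u v with hC
    have hCmem : ∀ z ∈ K, ∀ v, IsActive 𝒜 n u v → z ∈ translate (𝒜 n) v → v ∈ C :=
      fun z hz v hv hzv => Finset.mem_filter.2 ⟨Finset.mem_image.2
        ⟨(z, z - v), by simp [hz, mem_translate.1 hzv], by simp⟩, hv⟩
    have hact : ∀ v ∈ C, IsActive 𝒜 n u v := fun v hv => (Finset.mem_filter.1 hv).2
    have hdisj : ∀ v ∈ C, ∀ v' ∈ C, v ≠ v' →
        Disjoint (translate (𝒜 n) v) (translate (𝒜 n) v') := fun v hv v' hv' hne =>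
      Finset.disjoint_left.2 fun z hz hz' => hne ((hact v hv).1.eq (hact v' hv').1 hz hz')
    obtain ⟨ℓ, h1, h2, h3, h4⟩ := ih (K ∪ C.biUnion (translate (𝒜 n)))
    refine ⟨C.toList.map (fun v => (𝒜 n, v)) ++ ℓ, ?_, ?_, ?_, ?_⟩
    · rw [List.map_append, List.nodup_append', List.map_map]
      refine ⟨?_, h1, ?_⟩
      · refine List.Nodup.map_on (fun v hv v' hv' h => ?_) C.nodup_toList
        rw [Finset.mem_toList] at hv hv'
        by_contra hne
        obtain ⟨a, ha⟩ := (hact v hv).nonempty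
        have ha' : a + v ∈ translate (𝒜 n) v := by rw [mem_translate]; simpa
        simp only [Function.comp_apply] at h
        exact Finset.disjoint_left.1 (hdisj v hv v' hv' hne) ha' (h ▸ ha')
      · intro B hB hB'
        obtain ⟨v, hv, rfl⟩ := List.mem_map.1 hB
        exact (hact v (Finset.mem_toList.1 hv)).2 (h2 _ hB').1
    · intro B hB
      rw [List.map_append, List.mem_append, List.map_map] at hB
      rcases hB with hB | hB
      · obtain ⟨v, hv, rfl⟩ := List.mem_map.1 hB
        have hv := hact v (Finset.mem_toList.1 hv)
        exact ⟨.inr ⟨v, hv.1, rfl⟩, fun h => hv.2 (Treated.mono (Nat.zero_le n) h)⟩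
      · exact ⟨.inl (h2 B hB).1, (h2 B hB).2⟩
    · intro B hB hB1 ⟨z, hz, hzB⟩
      rw [List.map_append, List.mem_append, List.map_map]
      by_cases hBn : Treated 𝒜 n u B
      · exact .inr (h3 B hBn hB1 ⟨z, by simp [hz], hzB⟩)
      · obtain ⟨v, hv, rfl⟩ := hB.resolve_left hBn
        exact .inl (List.mem_map.2 ⟨v, Finset.mem_toList.2 (hCmem z hz v ⟨hv, hBn⟩ hzB), rfl⟩)
    · intro u' hu' z hz
      have hpw : C.toList.Pairwise
          fun v v' => Disjoint (translate (𝒜 n) v) (translate (𝒜 n) v') :=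
        C.nodup_toList.imp_of_mem fun hv hv' hne =>
          hdisj _ (Finset.mem_toList.1 hv) _ (Finset.mem_toList.1 hv') hne
      obtain ⟨ha, hb⟩ := sequential_append (q := q) (p := p) (𝒜 n) C.toList hpw ℓ u' z
      by_cases h : ∃ v, IsActive 𝒜 n u' v ∧ z ∈ translate (𝒜 n) v
      · obtain ⟨v, hv, hzv⟩ := h
        have hvC := hCmem z hz v ((isActive_congr hu' v).2 hv) hzv
        rw [stage_succ_of_active hv hzv, ha v (Finset.mem_toList.2 hvC) hzv]
        have h : ∀ a ∈ translate (𝒜 n) v, stage q p 𝒜 n u' a = sequential q p ℓ u' a :=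
          fun a ha => h4 u' hu' a (Finset.mem_union_right _ (Finset.mem_biUnion.2 ⟨v, hvC, ha⟩))
        exact step_congr h rfl (fun _ _ _ => rfl) (h z hzv)
      · push Not at h
        rw [stage_succ_of_not h, hb fun v hv => h v ((isActive_congr hu' v).1
          (hact v (Finset.mem_toList.1 hv))), h4 u' hu' z (by simp [hz])]

/-- Condition on the coins that choose the centres. They determine the treated sets, hence the list
of `exists_sequential`, while the remaining coins are independent of them and drive the revelations.
-/
theorem inputLaw_stage_emptyOn [Countable V] (hq : 0 < (q : ℝ)) (hp1 : ∀ v, p {v} = q) (n : ℕ)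
    (E : Finset V) :
    inputLaw V {u | stage q p 𝒜 n u ∈ emptyOn E}
      = ∫⁻ u, bernoulliFamily p (noneSelected {B | Treated 𝒜 n u B} E) ∂(inputLaw V) := by
  classical
  have hm : MeasurableSet {u : Input V | stage q p 𝒜 n u ∈ emptyOn E} :=
    measurable_stage n (measurableSet_emptyOn E)
  rw [← lintegral_indicator_one hm, lintegral_infinitePi_piecewise _
    {i | ∃ m, i.2 = .inr (.inr (some m))} (measurable_one.indicator hm)]
  refine lintegral_congr fun u => ?_
  obtain ⟨ℓ, h1, h2, h3, h4⟩ := exists_sequential (q := q) (p := p) (𝒜 := 𝒜) n u E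
  have hset : noneSelected {B | Treated 𝒜 n u B} E
      = noneSelected {B | B.card ≤ 1 ∨ B ∈ ℓ.map fun x => translate x.1 x.2} E := by
    ext X
    refine forall_congr' fun A => ?_
    have : (∃ v ∈ E, v ∈ A.1) → (A.1 ∈ {B | Treated 𝒜 n u B} ↔
        A.1 ∈ {B | B.card ≤ 1 ∨ B ∈ ℓ.map fun x => translate x.1 x.2}) := by
      intro hE
      refine ⟨fun h => ?_, fun h => ?_⟩
      · by_cases hc : A.1.card ≤ 1
        · exact .inl hc
        · exact .inr (h3 _ h hc hE)
      · exact h.elim (fun hc => Treated.mono (Nat.zero_le n) hc) fun h => (h2 _ h).1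
    exact ⟨fun h ha hE => h ((this hE).2 ha) hE, fun h ha hE => h ((this hE).1 ha) hE⟩
  rw [hset, ← inputLaw_sequential_emptyOn hq hp1 ℓ h1 (fun B hB => (h2 B hB).2)]
  refine lintegral_congr fun w => ?_
  set u' : Input V := Set.piecewise {i | ∃ m, i.2 = .inr (.inr (some m))} u w with hu'
  have e1 : ∀ z ∈ E, stage q p 𝒜 n u' z = sequential q p ℓ u' z := h4 u' fun z m =>
    (Set.piecewise_eq_of_mem _ _ _ (by simp)).symm
  have e2 : sequential q p ℓ u' = sequential q p ℓ w := by
    refine sequential_congr ℓ (fun z => Set.piecewise_eq_of_notMem _ _ _ (by simp))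
      fun x _ i => Set.piecewise_eq_of_notMem _ _ _ ?_
    rcases i with _ | i <;> simp [revealIndex]
  have : u' ∈ {u | stage q p 𝒜 n u ∈ emptyOn E} ↔ sequential q p ℓ w ∈ emptyOn E :=
    forall₂_congr fun z hz => by rw [e1 z hz, e2]
  simp only [Set.indicator, this, Pi.one_apply]

end StageLaw

/-! ### Convergence to the final configuration and identification of its law -/

section Coding

variable {V : Type*} [AddCommGroup V] [DecidableEq V] {q : I} {p : Finset V → I}
  {𝒜 : ℕ → Finset V}

omit [DecidableEq V] in
theorem measurePreserving_shiftInput (w : V) :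
    MeasurePreserving (shiftInput w) (inputLaw V) (inputLaw V) where
  measurable := measurable_pi_iff.2 fun i => measurable_pi_apply _
  map_eq := Measure.map_infinitePi_infinitePi_of_inj
    (P := fun _ : V × Label V => (volume : Measure I)) (α := V × Label V) (f := fun i : V × Label V => (i.1 - w, i.2)) (by
      rintro ⟨a, l⟩ ⟨b, l'⟩ h
      simpa using h)

/-- Every nonempty finite set that occurs infinitely often in the enumeration is revealed. -/
theorem ae_exists_treated [Countable V] {B : Finset V}
    (hB : ∃ᶠ n in Filter.atTop, 𝒜 n = B) :
    ∀ᵐ u ∂(inputLaw V), ∃ n, Treated 𝒜 n u B := by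
  classical
  set K : Finset V := insert 0 ((B ×ˢ B).image fun x => x.1 - x.2) with hK
  let t : V × Label V → Set I := fun i => if i.1 = 0 then Set.Iic half else Set.Ioi half
  have ht : ∀ i, MeasurableSet (t i) := fun i => by
    by_cases h : i.1 = 0
    · simp only [t, h, if_true]; exact measurableSet_Iic
    · simp only [t, h, if_false]; exact measurableSet_Ioi
  let ψ : ℕ → V ↪ V × Label V := fun n =>
    ⟨fun z => (z, .inr (.inr (some n))), fun a b h => (Prod.mk.inj h).1⟩
  -- At time n the origin is chosen and no nonzero difference of points of B is, so the origin is a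
  -- centre whenever `𝒜 n = B`. The probability 2^{-|K|} does not depend on n.
  let S : ℕ → Set (Input V) := fun n => Set.pi (K.map (ψ n)) t
  have hψ : ∀ n z, t (ψ n z) = if z = 0 then Set.Iic half else Set.Ioi half := fun _ _ => rfl
  have hS : ∀ n, MeasurableSet (S n) := fun n => .pi (Finset.countable_toSet _) fun i _ => ht i
  have hμS : ∀ n, inputLaw V (S n) = ENNReal.ofReal (1 / 2) ^ K.card := by
    intro n
    rw [inputLaw, Measure.infinitePi_pi _ fun i _ => ht i, Finset.prod_map]
    refine Finset.prod_eq_pow_card fun z _ => ?_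
    by_cases h : z = 0
    · rw [hψ, if_pos h, unitInterval.volume_Iic, half]
    · rw [hψ, if_neg h, unitInterval.volume_Ioi, half]
      norm_num
  have hcen : ∀ n, 𝒜 n = B → ∀ u ∈ S n, Treated 𝒜 (n + 1) u B := by
    intro n hn u hu
    refine .inr ⟨0, ⟨?_, ?_⟩, by simp [hn]⟩
    · have := hu (ψ n 0) (by simp [hK])
      rw [hψ, if_pos rfl] at this
      exact this
    · intro a ha b hb hab
      rw [hn] at ha hb
      have h0 : (0 : V) + a - b ≠ 0 := by simpa [sub_eq_zero] using hab
      have := hu (ψ n (0 + a - b)) (by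
        simp only [Finset.coe_map, Set.mem_image, Finset.mem_coe, EmbeddingLike.apply_eq_iff_eq,
          exists_eq_right]
        exact Finset.mem_insert_of_mem (Finset.mem_image.2 ⟨(a, b), by simp [ha, hb], by simp⟩))
      rw [hψ, if_neg h0] at this
      exact not_le.2 this
  have hc1 : 1 - ENNReal.ofReal (1 / 2) ^ K.card < 1 :=
    ENNReal.sub_lt_self ENNReal.one_ne_top one_ne_zero (by simp)
  refine measure_mono_null (t := ⋂ m : ℕ, {u | ¬ Treated 𝒜 m u B}) (fun u hu => by
    simpa using hu) ?_
  refine le_antisymm (ge_of_tendsto' (ENNReal.tendsto_pow_atTop_nhds_zero_of_lt_one hc1)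
    fun m => ?_) bot_le
  obtain ⟨s, hs, hsm⟩ := (Nat.frequently_atTop_iff_infinite.1 hB).exists_subset_card_eq m
  calc inputLaw V (⋂ m : ℕ, {u | ¬ Treated 𝒜 m u B})
      ≤ inputLaw V (⋂ n ∈ s, (S n)ᶜ) := measure_mono fun u hu => by
        simp only [Set.mem_iInter, Set.mem_ofPred_eq] at hu ⊢
        exact fun n hn hun => hu (n + 1) (hcen n (hs hn) u hun)
    _ = ∏ n ∈ s, inputLaw V (S n)ᶜ := by
        refine infinitePi_biInter_of_dependsOn _ s (fun n => {i | i.2 = .inr (.inr (some n))})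
          (fun n => (S n)ᶜ) (fun n _ => (hS n).compl) (fun n _ u w h hu hw => hu ?_) ?_
        · intro i hi
          rw [h i]
          · exact hw i hi
          · obtain ⟨z, -, rfl⟩ := Finset.mem_map.1 hi
            rfl
        · intro n _ n' _ hne
          refine Set.disjoint_left.2 fun i hi hi' => hne ?_
          simpa using hi.symm.trans hi'
    _ = (1 - ENNReal.ofReal (1 / 2) ^ K.card) ^ m := by
        rw [← hsm]
        refine Finset.prod_eq_pow_card fun n _ => ?_
        rw [prob_compl_eq_one_sub (hS n), hμS]

variable (q p) in
/-- The value at the origin may change when the set `D` is revealed. -/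
def IsAlert (u : Input V) (D : Finset V) : Prop :=
  ((u (0, .inl (false, D)) : I) : ℝ) ≤ p D * ((q : ℝ)⁻¹) ^ D.card

variable (q p 𝒜) in
/-- At time `n` the value at the origin is final. -/
def IsFinal (n : ℕ) (u : Input V) : Prop :=
  ∀ D : Finset V, 0 ∈ D → IsAlert q p u D → Treated 𝒜 n u D

omit [DecidableEq V] in
theorem IsFinal.mono {n m : ℕ} {u : Input V} (h : IsFinal q p 𝒜 n u) (hnm : n ≤ m) :
    IsFinal q p 𝒜 m u := fun D h0 hD => (h D h0 hD).mono hnm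

theorem volume_coe_le (r : ℝ) (hr : 0 ≤ r) :
    (volume : Measure I) {x | (x : ℝ) ≤ r} ≤ ENNReal.ofReal r := by
  let s : I := ⟨min r 1, le_min hr zero_le_one, min_le_right _ _⟩
  calc (volume : Measure I) {x | (x : ℝ) ≤ r} ≤ volume (Set.Iic s) :=
        measure_mono fun x hx => Set.mem_Iic.2 (Subtype.coe_le_coe.1 (le_min hx x.2.2))
    _ = ENNReal.ofReal (min r 1) := by rw [unitInterval.volume_Iic]
    _ ≤ ENNReal.ofReal r := ENNReal.ofReal_le_ofReal (min_le_left _ _)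

/-- Borel-Cantelli: the sum bounds the expected number of alert sets containing the origin. Almost
surely there are finitely many, and each is treated at some time. -/
theorem ae_exists_isFinal [Countable V] (h𝒜 : ∀ B, ∃ᶠ n in Filter.atTop, 𝒜 n = B)
    (hsum : Summable fun A : {A : Finset V // 0 ∈ A} =>
      (p A.1 : ℝ) * ((q : ℝ)⁻¹) ^ A.1.card) :
    ∀ᵐ u ∂(inputLaw V), ∃ n, IsFinal q p 𝒜 n u := by
  have hfin : ∀ᵐ u ∂(inputLaw V), {D : {A : Finset V // 0 ∈ A} | u ∈
      {u : Input V | IsAlert q p u D.1}}.Finite := by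
    refine ae_finite_setOfPred_mem ?_
    refine ne_top_of_le_ne_top hsum.tsum_ofReal_ne_top (ENNReal.tsum_le_tsum fun D => ?_)
    have h0 : 0 ≤ (p D.1 : ℝ) * ((q : ℝ)⁻¹) ^ D.1.card :=
      mul_nonneg (p D.1).2.1 (pow_nonneg (inv_nonneg.2 q.2.1) _)
    refine le_trans (le_of_eq ?_) (volume_coe_le _ h0)
    rw [← Measure.infinitePi_map_eval (fun _ : V × Label V => (volume : Measure I))
      (0, .inl (false, D.1)), Measure.map_apply (measurable_pi_apply _)]
    · rfl
    · exact measurableSet_le measurable_subtype_coe measurable_const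
  have htr : ∀ᵐ u ∂(inputLaw V), ∀ B : Finset V, ∃ n, Treated 𝒜 n u B :=
    ae_all_iff.2 fun B => ae_exists_treated (h𝒜 B)
  filter_upwards [hfin, htr] with u hu ht
  choose N hN using ht
  refine ⟨hu.toFinset.sup fun D => N D.1, fun D h0 hD => (hN D).mono ?_⟩
  exact Finset.le_sup (f := fun D : {A : Finset V // 0 ∈ A} => N D.1) (b := ⟨D, h0⟩)
    (by simpa using hD)

/-- The configuration of a state. -/
def occupied (b : Bool × Bool) : Bool := b.1 || b.2

/-- A set containing the origin that is revealed after time n was untreated then, hence is not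
alert, and `step_or_of_lt` applies. -/
theorem occupied_stage_eq (hq : 0 < (q : ℝ)) {n m : ℕ} {u : Input V}
    (h : IsFinal q p 𝒜 n u) (hnm : n ≤ m) :
    occupied (stage q p 𝒜 m u 0) = occupied (stage q p 𝒜 n u 0) := by
  induction m, hnm using Nat.le_induction with
  | base => rfl
  | succ m hm ih =>
    rw [← ih]
    by_cases hv : ∃ v, IsActive 𝒜 m u v ∧ 0 ∈ translate (𝒜 m) v
    · obtain ⟨v, hv, h0⟩ := hv
      rw [stage_succ_of_active hv h0]
      refine step_or_of_lt hq p _ _ _ _ _ ?_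
      have : ¬ IsAlert q p u (translate (𝒜 m) v) := fun hal => hv.2 ((h _ h0 hal).mono hm)
      simpa [IsAlert, revealIndex] using this
    · push Not at hv
      rw [stage_succ_of_not hv]

open Classical in
variable (q p 𝒜) in
/-- The final value at the origin. -/
noncomputable def originValue (u : Input V) : Bool :=
  if h : ∃ n, IsFinal q p 𝒜 n u then occupied (stage q p 𝒜 (Nat.find h) u 0) else false

theorem originValue_eq (hq : 0 < (q : ℝ)) {n : ℕ} {u : Input V} (h : IsFinal q p 𝒜 n u) :
    originValue q p 𝒜 u = occupied (stage q p 𝒜 n u 0) := by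
  classical
  have hex : ∃ n, IsFinal q p 𝒜 n u := ⟨n, h⟩
  rw [originValue, dif_pos hex]
  exact (occupied_stage_eq hq (Nat.find_spec hex) (Nat.find_min' hex h)).symm

omit [DecidableEq V] in
theorem measurableSet_isFinal [Countable V] (n : ℕ) :
    MeasurableSet {u : Input V | IsFinal q p 𝒜 n u} := by
  have : {u : Input V | IsFinal q p 𝒜 n u} = ⋂ D : Finset V, ⋂ (_ : 0 ∈ D),
      ({u | IsAlert q p u D}ᶜ ∪ {u | Treated 𝒜 n u D}) := by
    ext u
    simp only [IsFinal, Set.mem_ofPred_eq, Set.mem_iInter, Set.mem_union, Set.mem_compl_iff,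
      imp_iff_not_or]
  rw [this]
  refine .iInter fun D => .iInter fun _ => .union (MeasurableSet.compl ?_) (measurableSet_treated n D)
  exact measurableSet_le (measurable_subtype_coe.comp (measurable_pi_apply _)) measurable_const

theorem measurable_occupied_stage [Countable V] (n : ℕ) (z : V) :
    Measurable fun u : Input V => occupied (stage q p 𝒜 n u z) :=
  (measurable_of_finite occupied).comp (measurable_pi_iff.1 (measurable_stage n) z)

/-- The default value `false` keeps inputs that never become final out of this preimage. -/
theorem preimage_originValue (hq : 0 < (q : ℝ)) :
    originValue q p 𝒜 ⁻¹' {true}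
      = ⋃ n, {u | IsFinal q p 𝒜 n u ∧ occupied (stage q p 𝒜 n u 0) = true} := by
  ext u
  simp only [Set.mem_preimage, Set.mem_singleton_iff, Set.mem_iUnion, Set.mem_ofPred_eq]
  constructor
  · intro h
    by_cases hex : ∃ n, IsFinal q p 𝒜 n u
    · obtain ⟨n, hn⟩ := hex
      exact ⟨n, hn, by rwa [← originValue_eq hq hn]⟩
    · rw [originValue, dif_neg hex] at h
      simp at h
  · rintro ⟨n, hn, h⟩
    rwa [originValue_eq hq hn]

theorem measurable_originValue [Countable V] (hq : 0 < (q : ℝ)) :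
    Measurable (originValue q p 𝒜) := by
  refine measurable_to_bool ?_
  rw [preimage_originValue hq]
  exact .iUnion fun n => (measurableSet_isFinal n).inter
    (measurable_occupied_stage n 0 (measurableSet_singleton true))

omit [DecidableEq V] in
theorem tendsto_bernoulliFamily_noneSelected [Countable V] {u : Input V}
    (hu : ∀ B, ∃ n, Treated 𝒜 n u B) (E : Finset V) :
    Filter.Tendsto (fun n => bernoulliFamily p (noneSelected {B | Treated 𝒜 n u B} E))
      Filter.atTop (nhds (unionLaw p (vanishing E))) := by
  have : noneSelected Set.univ E = ⋂ n, noneSelected {B | Treated 𝒜 n u B} E := by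
    ext X
    simp only [Set.mem_iInter]
    constructor
    · exact fun h n A _ hE => h A trivial hE
    · intro h A _ hE
      obtain ⟨n, hn⟩ := hu A.1
      exact h n A hn hE
  rw [unionLaw_vanishing, this]
  refine tendsto_measure_iInter_atTop
    (fun n => (measurableSet_noneSelected _ E).nullMeasurableSet) ?_ ⟨0, by simp⟩
  exact fun n m hnm X h A hA hE => h A (Treated.mono hnm hA) hE

omit [DecidableEq V] in
theorem measurable_bernoulliFamily_noneSelected [Countable V] (n : ℕ) (E : Finset V) :
    Measurable fun u : Input V =>
      bernoulliFamily p (noneSelected {B | Treated 𝒜 n u B} E) := by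
  refine measurable_measure_prodMk_left (ν := bernoulliFamily p)
    (s := {z : Input V × _ | z.2 ∈ noneSelected {B | Treated 𝒜 n z.1 B} E}) ?_
  have : {z : Input V × ({A : Finset V // A.Nonempty} → Bool) |
      z.2 ∈ noneSelected {B | Treated 𝒜 n z.1 B} E}
      = ⋂ A : {A : Finset V // A.Nonempty}, ⋂ (_ : ∃ v ∈ E, v ∈ A.1),
        ({z | Treated 𝒜 n z.1 A.1}ᶜ ∪ {z | z.2 A = false}) := by
    ext z
    simp only [noneSelected, Set.mem_ofPred_eq, Set.mem_iInter, Set.mem_union, Set.mem_compl_iff]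
    refine forall_congr' fun A => ?_
    rw [imp.swap]
    exact imp_congr Iff.rfl imp_iff_not_or
  rw [this]
  refine .iInter fun A => .iInter fun _ => .union (MeasurableSet.compl ?_) ?_
  · exact measurable_fst (measurableSet_treated n A.1)
  · have h : Measurable fun z : Input V × ({A : Finset V // A.Nonempty} → Bool) => z.2 A := by
      fun_prop
    exact h (measurableSet_singleton false)

/-- The law of the final configuration is the law of the random union. -/
theorem map_originValue [Countable V] (hq : 0 < (q : ℝ)) (hp1 : ∀ v, p {v} = q)
    (hp : ∀ (A : Finset V) (v : V), A.Nonempty → p (translate A v) = p A)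
    (h𝒜 : ∀ B, ∃ᶠ n in Filter.atTop, 𝒜 n = B)
    (hsum : Summable fun A : {A : Finset V // 0 ∈ A} =>
      (p A.1 : ℝ) * ((q : ℝ)⁻¹) ^ A.1.card) :
    (inputLaw V).map (fun u z => originValue q p 𝒜 (shiftInput (-z) u)) = unionLaw p := by
  have hm : Measurable fun (u : Input V) z => originValue q p 𝒜 (shiftInput (-z) u) :=
    measurable_pi_iff.2 fun z =>
      (measurable_originValue hq).comp (measurePreserving_shiftInput (-z)).measurable
  have := Measure.isProbabilityMeasure_map (μ := inputLaw V) hm.aemeasurable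
  refine ext_of_vanishing fun E => ?_
  rw [Measure.map_apply hm (measurableSet_vanishing E)]
  have hfinal : ∀ᵐ u ∂(inputLaw V), ∀ z : V, ∃ n, IsFinal q p 𝒜 n (shiftInput (-z) u) :=
    ae_all_iff.2 fun z => (measurePreserving_shiftInput (-z)).quasiMeasurePreserving.ae
      (ae_exists_isFinal h𝒜 hsum)
  have htr : ∀ᵐ u ∂(inputLaw V), ∀ B : Finset V, ∃ n, Treated 𝒜 n u B :=
    ae_all_iff.2 fun B => ae_exists_treated (h𝒜 B)
  -- Two limits of one sequence are compared: here by almost sure stabilisation on E, below because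
  -- the treated sets increase to all sets.
  have h1 : Filter.Tendsto (fun n => inputLaw V {u | stage q p 𝒜 n u ∈ emptyOn E}) Filter.atTop
      (nhds (inputLaw V ((fun (u : Input V) z => originValue q p 𝒜 (shiftInput (-z) u)) ⁻¹'
        vanishing E))) := by
    refine tendsto_measure_of_ae_tendsto_indicator_of_isFiniteMeasure Filter.atTop
      (hm (measurableSet_vanishing E)) (fun n => measurable_stage n (measurableSet_emptyOn E)) ?_
    filter_upwards [hfinal] with u hu
    choose N hN using hu
    filter_upwards [Filter.eventually_ge_atTop (E.sup N)] with n hn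
    refine forall₂_congr fun z hz => ?_
    change _ ↔ originValue q p 𝒜 (shiftInput (-z) u) = false
    rw [originValue_eq hq ((hN z).mono ((Finset.le_sup hz).trans hn)), stage_shift hp]
    simp [occupied]
  have h2 : Filter.Tendsto (fun n => inputLaw V {u | stage q p 𝒜 n u ∈ emptyOn E}) Filter.atTop
      (nhds (unionLaw p (vanishing E))) := by
    have : unionLaw p (vanishing E) = ∫⁻ _, unionLaw p (vanishing E) ∂(inputLaw V) := by simp
    rw [this]
    simp only [inputLaw_stage_emptyOn hq hp1]
    refine tendsto_lintegral_of_dominated_convergence (fun _ => 1)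
      (fun n => measurable_bernoulliFamily_noneSelected n E)
      (fun n => Filter.Eventually.of_forall fun u => prob_le_one) (by simp) ?_
    filter_upwards [htr] with u hu
    exact tendsto_bernoulliFamily_noneSelected hu E
  exact tendsto_nhds_unique h1 h2

end Coding

/-! ### From local decisions to a coding radius -/

section Finitary

variable {d : ℕ}

theorem singleton_eq_of_translationInvariant {p : Finset (Fin d → ℤ) → I}
    (hp : TranslationInvariant p) (v : Fin d → ℤ) : p {v} = p {0} := by
  have := hp {0} v (Finset.singleton_nonempty 0)
  rwa [Finset.map_singleton, addRightEmbedding_apply, zero_add] at this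

open Classical in
/-- A factor map is finitary if its value at the origin is decided at the first of an increasing
sequence of events, the `n`-th of which only depends on the input in a ball of radius `ρ n`. -/
theorem isFinitaryFactorOfIID_of_decided {ν : Measure ((Fin d → ℤ) → Bool)} {S : Type}
    [MeasurableSpace S] [StandardBorelSpace S] (μ : Measure S) [IsProbabilityMeasure μ]
    (F : ((Fin d → ℤ) → S) → ((Fin d → ℤ) → Bool)) (hF : Measurable F)
    (hlaw : (Measure.infinitePi fun _ : Fin d → ℤ => μ).map F = ν)
    (hshift : ∀ v u, F (shift v u) = shift v (F u))
    (ρ : ℕ → ℕ) (hρ : Monotone ρ) (G : ℕ → Set ((Fin d → ℤ) → S))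
    (hG : ∀ n, MeasurableSet[ballFiltration d S (ρ n)] (G n))
    (hGae : ∀ᵐ u ∂(Measure.infinitePi fun _ : Fin d → ℤ => μ), ∃ n, u ∈ G n)
    (H : ℕ → Set ((Fin d → ℤ) → S)) (hH : ∀ n, MeasurableSet[ballFiltration d S (ρ n)] (H n))
    (hFG : ∀ n, ∀ u ∈ G n, F u 0 = true ↔ u ∈ H n)
    (hFtop : ∀ u, F u 0 = true → ∃ n, u ∈ G n) :
    IsFinitaryFactorOfIID ν := by
  let R : ((Fin d → ℤ) → S) → WithTop ℕ := fun u =>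
    if h : ∃ n, u ∈ G n then WithTop.some (ρ (Nat.find h)) else ⊤
  have hRle : ∀ i : ℕ, ∀ u, R u ≤ WithTop.some i ↔ ∃ n, ρ n ≤ i ∧ u ∈ G n := by
    intro i u
    by_cases h : ∃ n, u ∈ G n
    · simp only [R, dif_pos h]
      rw [WithTop.coe_le_coe]
      exact ⟨fun hi => ⟨_, hi, Nat.find_spec h⟩,
        fun ⟨n, hn, hu⟩ => (hρ (Nat.find_min' h hu)).trans hn⟩
    · simp only [R, dif_neg h]
      exact ⟨fun hi => absurd hi (by simp), fun ⟨n, _, hu⟩ => absurd ⟨n, hu⟩ h⟩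
  have hGi : ∀ i n, ρ n ≤ i → MeasurableSet[ballFiltration d S i] (G n) := fun i n h =>
    (ballFiltration d S).mono h _ (hG n)
  have hHi : ∀ i n, ρ n ≤ i → MeasurableSet[ballFiltration d S i] (H n) := fun i n h =>
    (ballFiltration d S).mono h _ (hH n)
  have hR : IsStoppingTime (ballFiltration d S) R := by
    intro i
    have : {u | R u ≤ WithTop.some i} = ⋃ n, ⋃ (_ : ρ n ≤ i), G n := by
      ext u
      simp only [Set.mem_ofPred_eq, hRle, Set.mem_iUnion, exists_prop]
    rw [this]
    exact .iUnion fun n => .iUnion fun h => hGi i n h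
  refine ⟨S, inferInstance, inferInstance, μ, inferInstance, F, R, hR, hF, hlaw,
    fun v => .of_forall (hshift v), ?_, ?_⟩
  · filter_upwards [hGae] with u hu
    simp [R, dif_pos hu]
  · refine @measurable_to_bool _ hR.measurableSpace _ ?_
    rw [IsStoppingTime.measurableSet]
    constructor
    · have : (fun u => F u 0) ⁻¹' {true} = ⋃ n, (G n ∩ H n) := by
        ext u
        simp only [Set.mem_preimage, Set.mem_singleton_iff, Set.mem_iUnion, Set.mem_inter_iff]
        constructor
        · intro h
          obtain ⟨n, hn⟩ := hFtop u h
          exact ⟨n, hn, (hFG n u hn).1 h⟩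
        · exact fun ⟨n, hn, h⟩ => (hFG n u hn).2 h
      rw [this]
      exact .iUnion fun n => le_iSup (fun t => (ballFiltration d S : ℕ → MeasurableSpace _) t) (ρ n) _
        ((hG n).inter (hH n))
    · intro i
      have : (fun u => F u 0) ⁻¹' {true} ∩ {u | R u ≤ WithTop.some i}
          = ⋃ n, ⋃ (_ : ρ n ≤ i), (G n ∩ H n) := by
        ext u
        simp only [Set.mem_preimage, Set.mem_singleton_iff, Set.mem_iUnion, Set.mem_inter_iff,
          Set.mem_ofPred_eq, hRle, exists_prop]
        constructor
        · rintro ⟨h, n, hn, hu⟩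
          exact ⟨n, hn, hu, (hFG n u hu).1 h⟩
        · rintro ⟨n, hn, hu, h⟩
          exact ⟨(hFG n u hu).2 h, n, hn, hu⟩
      rw [this]
      exact .iUnion fun n => .iUnion fun h => (hGi i n h).inter (hHi i n h)

/-- Every finite set of sites is contained in a ball. -/
theorem exists_norm_le (K : Finset (Fin d → ℤ)) : ∃ r : ℕ, ∀ z ∈ K, ‖z‖ ≤ (r : ℝ) := by
  refine ⟨K.sup fun z => ⌈‖z‖⌉₊, fun z hz => (Nat.le_ceil _).trans ?_⟩
  exact_mod_cast Finset.le_sup (f := fun z : Fin d → ℤ => ⌈‖z‖⌉₊) hz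

/-- The finitary coding of a random union with a convergent exponential sum. -/
theorem isFinitaryFactorOfIID_unionLaw {p : Finset (Fin d → ℤ) → I}
    (hp : TranslationInvariant p) (h0 : 0 < (p {0} : ℝ))
    (hsum : Summable fun A : {A : Finset (Fin d → ℤ) // 0 ∈ A} =>
      (p A.1 : ℝ) * ((p {0} : ℝ)⁻¹) ^ A.1.card) :
    IsFinitaryFactorOfIID (unionLaw p) := by
  set q := p {0} with hq
  have hp1 : ∀ v, p {v} = q := singleton_eq_of_translationInvariant hp
  obtain ⟨e, he⟩ := exists_surjective_nat (Finset (Fin d → ℤ))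
  -- The ignored second coordinate of the pairing makes every set recur infinitely often.
  let 𝒜 : ℕ → Finset (Fin d → ℤ) := fun n => e n.unpair.1
  have h𝒜 : ∀ B, ∃ᶠ n in Filter.atTop, 𝒜 n = B := by
    intro B
    obtain ⟨k, rfl⟩ := he B
    refine Filter.frequently_atTop.2 fun N => ⟨Nat.pair k N, Nat.right_le_pair k N, ?_⟩
    simp [𝒜]
  have hdep : ∀ n, ∃ r : ℕ, ∀ u u' : Input (Fin d → ℤ), (∀ z, ‖z‖ ≤ (r : ℝ) → ∀ l, u (z, l) = u' (z, l)) →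
      (IsFinal q p 𝒜 n u ↔ IsFinal q p 𝒜 n u') ∧ stage q p 𝒜 n u 0 = stage q p 𝒜 n u' 0 := by
    intro n
    obtain ⟨K', hK'⟩ := exists_dependence (q := q) (p := p) (𝒜 := 𝒜) n {0}
    obtain ⟨r, hr⟩ := exists_norm_le K'
    refine ⟨r, fun u u' h => ?_⟩
    obtain ⟨h1, h2⟩ := hK' u u' fun z hz => h z (hr z hz)
    refine ⟨forall₂_congr fun D hD => ?_, h2 0 (by simp)⟩
    rw [IsAlert, IsAlert, h 0 (by simp), h1 D ⟨0, by simp, hD⟩]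
  choose r hr using hdep
  -- Partial sums turn the radii r into a monotone sequence that dominates them.
  let ρ : ℕ → ℕ := fun n => ∑ m ∈ Finset.range (n + 1), r m
  have hρ : Monotone ρ := fun n m h => Finset.sum_le_sum_of_subset (by simpa using h)
  have hrρ : ∀ n, r n ≤ ρ n := fun n =>
    Finset.single_le_sum (f := r) (fun _ _ => Nat.zero_le _) (by simp)
  -- All coins of a site are bundled into one variable with values in I^Label.
  let unc : ((Fin d → ℤ) → Label (Fin d → ℤ) → I) → Input (Fin d → ℤ) := fun U i => U i.1 i.2
  have hunc : Measurable unc := by fun_prop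
  have hball : ∀ {β : Type} [MeasurableSpace β] (n : ℕ) (f : Input (Fin d → ℤ) → β),
      Measurable f → (∀ u u', (∀ z, ‖z‖ ≤ (r n : ℝ) → ∀ l, u (z, l) = u' (z, l)) → f u = f u') →
      Measurable[ballFiltration d (Label (Fin d → ℤ) → I) (ρ n)] (f ∘ unc) := by
    intro β _ n f hf h
    refine measurable_cylinderEvents_of_dependsOn (hf.comp hunc) fun U U' hU => ?_
    refine h _ _ fun z hz l => ?_
    exact congrFun (hU z (hz.trans (Nat.cast_le.2 (hrρ n)))) l
  have hlaw : (Measure.infinitePi fun _ : Fin d → ℤ =>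
      (Measure.infinitePi fun _ : Label (Fin d → ℤ) => (volume : Measure I))).map unc
      = inputLaw (Fin d → ℤ) :=
    Measure.infinitePi_map_curry_symm fun (_ : Fin d → ℤ) (_ : Label (Fin d → ℤ)) =>
      (volume : Measure I)
  have hpt : ∀ (A : Finset (Fin d → ℤ)) (v : Fin d → ℤ), A.Nonempty → p (translate A v) = p A := hp
  have hFm : Measurable fun (u : Input (Fin d → ℤ)) z => originValue q p 𝒜 (shiftInput (-z) u) :=
    measurable_pi_iff.2 fun z =>
      (measurable_originValue h0).comp (measurePreserving_shiftInput (-z)).measurable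
  have hsh0 : ∀ u : Input (Fin d → ℤ), shiftInput (-0) u = u := fun u => by
    ext i; simp [shiftInput]
  refine isFinitaryFactorOfIID_of_decided
    (Measure.infinitePi fun _ : Label (Fin d → ℤ) => (volume : Measure I))
    (fun U z => originValue q p 𝒜 (shiftInput (-z) (unc U))) (hFm.comp hunc) ?_ ?_ ρ hρ
    (fun n => {U | IsFinal q p 𝒜 n (unc U)}) ?_ ?_
    (fun n => {U | occupied (stage q p 𝒜 n (unc U) 0) = true}) ?_ ?_ ?_
  · rw [← map_originValue h0 hp1 hpt h𝒜 hsum, ← hlaw, Measure.map_map hFm hunc]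
    rfl
  · intro v U
    ext z
    simp only [shift]
    congr 1
    ext i
    simp only [shiftInput, unc, shift]
    congr 2
    abel
  · intro n
    have h := hball n (fun u => IsFinal q p 𝒜 n u)
      (measurableSet_setOfPred.1 (measurableSet_isFinal n)) fun u u' h => propext (hr n u u' h).1
    convert h (measurableSet_singleton True) using 1
    ext U
    simp
  · have := ae_exists_isFinal (p := p) h𝒜 hsum
    rw [← hlaw] at this
    exact ae_of_ae_map hunc.aemeasurable this
  · intro n
    exact hball n (fun u => occupied (stage q p 𝒜 n u 0)) (measurable_occupied_stage n 0)
      (fun u u' h => by rw [(hr n u u' h).2]) (measurableSet_singleton true)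
  · intro n U hU
    rw [hsh0, originValue_eq h0 hU]
    rfl
  · intro U hU
    rw [hsh0] at hU
    by_contra hex
    rw [originValue, dif_neg (by simpa using hex)] at hU
    simp at hU

end Finitary

/-! ### Stability of finitary codings under independent noise -/

section Noise

/-- An independent pair of product measures is a product of pairs. -/
theorem map_zip_infinitePi {ι S T : Type*} [MeasurableSpace S] [MeasurableSpace T]
    (μ : Measure S) [IsProbabilityMeasure μ] (ν : Measure T) [IsProbabilityMeasure ν] :
    ((Measure.infinitePi fun _ : ι => μ).prod (Measure.infinitePi fun _ : ι => ν)).map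
        (fun z i => (z.1 i, z.2 i))
      = Measure.infinitePi fun _ : ι => μ.prod ν := by
  refine IsProjectiveLimit.unique (P := fun J : Finset ι => Measure.pi fun _ : J => μ.prod ν)
    (fun J => ?_) (Measure.isProjectiveLimit_infinitePi _)
  have h1 := (measurePreserving_arrowProdEquivProdArrow S T J (fun _ => μ) (fun _ => ν)).symm
  have h2 := h1.map_eq
  rw [← Measure.infinitePi_map_restrict (fun _ : ι => μ),
    ← Measure.infinitePi_map_restrict (fun _ : ι => ν),
    Measure.map_prod_map _ _ (by fun_prop) (by fun_prop), Measure.map_map (by fun_prop) (by fun_prop)]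
    at h2
  refine Eq.trans ?_ h2
  rw [Measure.map_map (by fun_prop) (by fun_prop)]
  rfl

theorem volume_gt (r : I) : (volume : Measure I) {x | decide (x ≤ r) = false} = weight (σ r) := by
  rw [← bernoulliMeasure_false, ← map_decide_le_volume,
    Measure.map_apply (measurable_decide_le r) (measurableSet_singleton _)]
  rfl

/-- Adding independent noise to a finitary factor of an IID process gives another one. -/
theorem IsFinitaryFactorOfIID.noise {d : ℕ} {ν ν' : Measure ((Fin d → ℤ) → Bool)}
    [IsProbabilityMeasure ν'] (h : IsFinitaryFactorOfIID ν) (r : I)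
    (hν' : ∀ E, ν' (vanishing E) = ν (vanishing E) * weight (σ r) ^ E.card) :
    IsFinitaryFactorOfIID ν' := by
  obtain ⟨S, _, _, μ, _, F, R, hR, hF, hlaw, hshift, hfin, hF0⟩ := h
  let fst : ((Fin d → ℤ) → S × I) → ((Fin d → ℤ) → S) := fun U z => (U z).1
  have hfst : Measurable fst := by fun_prop
  have hmap : (Measure.infinitePi fun _ : Fin d → ℤ => μ.prod (volume : Measure I)).map fst
      = Measure.infinitePi fun _ : Fin d → ℤ => μ := by
    have := Measure.infinitePi_map_pi (fun _ : Fin d → ℤ => μ.prod (volume : Measure I))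
      (f := fun _ x => x.1) (fun _ => measurable_fst)
    simpa using this
  have hfstn : ∀ n, Measurable[ballFiltration d (S × I) n, ballFiltration d S n] fst := by
    intro n
    refine measurable_cylinderEvents_iff.2 fun i hi => ?_
    exact measurable_fst.comp (measurable_cylinderEvent_apply hi)
  let F' : ((Fin d → ℤ) → S × I) → (Fin d → ℤ) → Bool := fun U z =>
    F (fst U) z || decide ((U z).2 ≤ r)
  have hnoise : ∀ z, Measurable fun U : (Fin d → ℤ) → S × I => decide ((U z).2 ≤ r) := fun z =>
    (measurable_decide_le r).comp (measurable_snd.comp (measurable_pi_apply z))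
  have hor : Measurable fun b : Bool × Bool => b.1 || b.2 := measurable_of_finite _
  have hF' : Measurable F' := measurable_pi_iff.2 fun z =>
    hor.comp (((measurable_pi_apply z).comp (hF.comp hfst)).prodMk (hnoise z))
  have hR' : IsStoppingTime (ballFiltration d (S × I)) fun U => R (fst U) := fun i =>
    hfstn i (hR i)
  refine ⟨S × I, inferInstance, inferInstance, μ.prod volume, inferInstance, F',
    fun U => R (fst U), hR', hF', ?_, ?_, ?_, ?_⟩
  · have := Measure.isProbabilityMeasure_map
      (μ := Measure.infinitePi fun _ : Fin d → ℤ => μ.prod (volume : Measure I)) hF'.aemeasurable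
    refine ext_of_vanishing fun E => ?_
    have hzip : Measurable fun (z : ((Fin d → ℤ) → S) × ((Fin d → ℤ) → I)) i => (z.1 i, z.2 i) := by
      fun_prop
    rw [hν', ← map_zip_infinitePi, Measure.map_map hF' hzip,
      Measure.map_apply (hF'.comp hzip) (measurableSet_vanishing E), ← hlaw,
      Measure.map_apply hF (measurableSet_vanishing E)]
    have : (F' ∘ fun (z : ((Fin d → ℤ) → S) × ((Fin d → ℤ) → I)) i => (z.1 i, z.2 i)) ⁻¹'
        vanishing E = (F ⁻¹' vanishing E) ×ˢ
          Set.pi E fun _ => {x : I | decide (x ≤ r) = false} := by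
      ext z
      simp only [vanishing, F', fst, Set.mem_preimage, Set.mem_ofPred_eq, Function.comp_apply,
        Bool.or_eq_false_iff, Set.mem_prod, Set.mem_pi, Finset.mem_coe]
      exact forall₂_and
    have hgt : MeasurableSet {x : I | decide (x ≤ r) = false} :=
      measurable_decide_le r (measurableSet_singleton false)
    rw [this, Measure.prod_prod, Measure.infinitePi_pi _ fun _ _ => hgt]
    simp only [volume_gt, Finset.prod_const]
  · intro v
    have := hshift v
    rw [← hmap] at this
    filter_upwards [ae_of_ae_map hfst.aemeasurable this] with U hU
    ext z
    have := congrFun hU z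
    simp only [F', shift] at this ⊢
    rw [← this]
    rfl
  · rw [← hmap] at hfin
    exact ae_of_ae_map hfst.aemeasurable hfin
  · have h1 : Measurable[hR'.measurableSpace] fun U => F (fst U) 0 := by
      refine @measurable_to_bool _ hR'.measurableSpace _ ?_
      have h := (IsStoppingTime.measurableSet hR _).1 (hF0 (measurableSet_singleton true))
      rw [IsStoppingTime.measurableSet]
      refine ⟨?_, fun i => hfstn i (h.2 i)⟩
      have hle : Measurable[⨆ t, ballFiltration d (S × I) t, ⨆ t, ballFiltration d S t] fst := by
        rw [measurable_iff_comap_le, MeasurableSpace.comap_iSup]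
        exact iSup_mono fun n => (hfstn n).comap_le
      exact hle h.1
    have h2 : Measurable[hR'.measurableSpace] fun U : (Fin d → ℤ) → S × I =>
        decide ((U 0).2 ≤ r) := by
      refine @measurable_to_bool _ hR'.measurableSpace _ ?_
      have h0 : ∀ i, MeasurableSet[ballFiltration d (S × I) i]
          ((fun U : (Fin d → ℤ) → S × I => decide ((U 0).2 ≤ r)) ⁻¹' {true}) := by
        intro i
        have h0 : Measurable[ballFiltration d (S × I) i] fun U : (Fin d → ℤ) → S × I => U 0 :=
          measurable_cylinderEvent_apply (by simp)
        exact ((measurable_decide_le r).comp (measurable_snd.comp h0)) (measurableSet_singleton true)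
      rw [IsStoppingTime.measurableSet]
      exact ⟨le_iSup (fun t => (ballFiltration d (S × I) : ℕ → MeasurableSpace _) t) 0 _ (h0 0),
        fun i => (h0 i).inter (hR' i)⟩
    exact hor.comp (h1.prodMk h2)

end Noise

/-! ### Monotonicity in the singleton probability and the threshold -/

section Threshold

variable {V : Type*} [Countable V]

omit [Countable V] in
theorem noneSelected_eq_pi (𝒯 : Set (Finset V)) (E : Finset V) :
    noneSelected 𝒯 E = Set.pi {A | A.1 ∈ 𝒯 ∧ ∃ v ∈ E, v ∈ A.1} fun _ => {false} := by
  ext X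
  simp only [noneSelected, Set.mem_ofPred_eq, Set.mem_pi, Set.mem_singleton_iff, and_imp]

/-- The singletons contribute a factor to the probability of vanishing on a finite set. -/
theorem unionLaw_withSingletons_vanishing (p : Finset V → I) (q : I) (E : Finset V) :
    unionLaw (withSingletons p q) (vanishing E)
      = weight (σ q) ^ E.card * bernoulliFamily p (noneSelected {B | ¬ B.card ≤ 1} E) := by
  classical
  have hsplit : noneSelected Set.univ E
      = noneSelected {B | B.card ≤ 1 ∨ B ∈ []} E ∩ noneSelected {B | ¬ B.card ≤ 1} E := by
    ext X
    constructor
    · exact fun h => ⟨fun A _ => h A trivial, fun A _ => h A trivial⟩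
    · rintro ⟨h1, h2⟩ A - hE
      by_cases hA : A.1.card ≤ 1
      · exact h1 A (.inl hA) hE
      · exact h2 A hA hE
  have h1 := bernoulliFamily_noneSelected (p := withSingletons p q) (q := q)
    (fun v => by simp [withSingletons]) E [] (by simp) (by simp)
  simp only [List.map_nil, List.prod_nil, mul_one] at h1
  have h2 : bernoulliFamily (withSingletons p q) (noneSelected {B | ¬ B.card ≤ 1} E)
      = bernoulliFamily p (noneSelected {B | ¬ B.card ≤ 1} E) := by
    rw [noneSelected_eq_pi, bernoulliFamily, bernoulliFamily,
      Measure.infinitePi_pi_of_countable _ (Set.to_countable _)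
        (fun _ _ => measurableSet_singleton _),
      Measure.infinitePi_pi_of_countable _ (Set.to_countable _)
        (fun _ _ => measurableSet_singleton _)]
    refine tprod_congr fun A => ?_
    have : A.1.1.card ≠ 1 := fun h => A.2.1 h.le
    simp [withSingletons, this]
  rw [unionLaw_vanishing, hsplit, ← h1, ← h2]
  refine infinitePi_inter_of_dependsOn _ (J := {A | A.1.card ≤ 1})
    (measurableSet_noneSelected _ E) (measurableSet_noneSelected _ E) ?_ ?_
  · intro X Y h hX A hA hE
    rw [← h A (by simpa using hA)]
    exact hX A hA hE
  · intro X Y h hX A hA hE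
    rw [← h A hA]
    exact hX A hA hE

/-- Noise of density r with 1 - q' = (1-q)(1-r) raises the singleton probability from q to q'. -/
theorem isFinitaryFactorOfIID_withSingletons_mono {d : ℕ} {p : Finset (Fin d → ℤ) → I} {q q' : I}
    (hqq : q ≤ q') (hq : (q : ℝ) < 1)
    (h : IsFinitaryFactorOfIID (unionLaw (withSingletons p q))) :
    IsFinitaryFactorOfIID (unionLaw (withSingletons p q')) := by
  have hqq' : (q : ℝ) ≤ q' := hqq
  have h1 : (0 : ℝ) < 1 - q := sub_pos.2 hq
  let r : I := ⟨(q' - q) / (1 - q), div_nonneg (sub_nonneg.2 hqq') h1.le,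
    div_le_one_of_le₀ (sub_le_sub_right q'.2.2 _) h1.le⟩
  have hw : weight (σ q') = weight (σ q) * weight (σ r) := by
    rw [weight, weight, weight, ← ENNReal.ofReal_mul (σ q).2.1]
    congr 1
    simp only [coe_symm_eq, r]
    field_simp
    ring
  refine h.noise r fun E => ?_
  rw [unionLaw_withSingletons_vanishing, unionLaw_withSingletons_vanishing, hw, mul_pow]
  ring

theorem translationInvariant_withSingletons {d : ℕ} {p : Finset (Fin d → ℤ) → I}
    (hp : TranslationInvariant p) (q : I) : TranslationInvariant (withSingletons p q) := by
  intro A v hA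
  simp only [withSingletons, Finset.card_map, hp A v hA]

/-- With an exponential moment, singletons of large density make the union a finitary factor. -/
theorem exists_isFinitaryFactorOfIID_withSingletons {d : ℕ} {p : Finset (Fin d → ℤ) → I}
    (hp : TranslationInvariant p) (hexp : HasExponentialMoment p) :
    ∃ q : I, (q : ℝ) < 1 ∧ IsFinitaryFactorOfIID (unionLaw (withSingletons p q)) := by
  classical
  obtain ⟨l, hl, hsum⟩ := hexp
  -- With this q, q^{-|A|} is exactly the exponential weight e^{l|A|}.
  let q : I := ⟨Real.exp (-l), (Real.exp_pos _).le, Real.exp_le_one_iff.2 (by linarith)⟩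
  have hq0 : (withSingletons p q) {0} = q := by simp [withSingletons]
  refine ⟨q, Real.exp_lt_one_iff.2 (by linarith), isFinitaryFactorOfIID_unionLaw
    (translationInvariant_withSingletons hp q) (by rw [hq0]; exact Real.exp_pos _) ?_⟩
  rw [hq0]
  have hinv : ((q : ℝ))⁻¹ = Real.exp l := by simp [q, Real.exp_neg]
  have hpow : ∀ n : ℕ, ((q : ℝ)⁻¹) ^ n = Real.exp (l * n) := fun n => by
    rw [hinv, ← Real.exp_nat_mul, mul_comm]
  -- Accounts for {0}, the only set in the sum whose probability was altered; its term is q · q⁻¹ =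
  -- 1.
  have h0 : Summable fun A : {A : Finset (Fin d → ℤ) // 0 ∈ A} =>
      if A = ⟨{0}, by simp⟩ then (1 : ℝ) else 0 :=
    (hasSum_ite_eq _ _).summable
  refine Summable.of_nonneg_of_le (fun A => ?_) (fun A => ?_) (hsum.add h0)
  · exact mul_nonneg ((withSingletons p q) A.1).2.1 (pow_nonneg (inv_nonneg.2 q.2.1) _)
  · rw [hpow]
    by_cases hA : A.1.card = 1
    · obtain ⟨v, hv⟩ := Finset.card_eq_one.1 hA
      have hv0 : v = 0 := by
        have := A.2
        rw [hv, Finset.mem_singleton] at this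
        exact this.symm
      have hA0 : A = ⟨{0}, by simp⟩ := Subtype.ext (by rw [hv, hv0])
      have h1 : (withSingletons p q A.1 : ℝ) * Real.exp (l * A.1.card) = 1 := by
        rw [← hpow, hA, pow_one, withSingletons, if_pos hA]
        exact mul_inv_cancel₀ (Real.exp_pos _).ne'
      rw [h1, if_pos hA0]
      have : 0 ≤ (p A.1 : ℝ) * Real.exp (l * A.1.card) :=
        mul_nonneg (p A.1).2.1 (Real.exp_pos _).le
      linarith
    · rw [withSingletons, if_neg hA]
      refine le_add_of_nonneg_right ?_
      split_ifs <;> norm_num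

theorem exists_isSingletonThreshold {d : ℕ} {p : Finset (Fin d → ℤ) → I}
    (hp : TranslationInvariant p) (hexp : HasExponentialMoment p) :
    ∃ c : ℝ, 0 ≤ c ∧ c < 1 ∧ IsSingletonThreshold p c := by
  set T : Set ℝ := {x | ∃ q : I, (q : ℝ) = x ∧ x < 1 ∧
    IsFinitaryFactorOfIID (unionLaw (withSingletons p q))} with hT
  obtain ⟨q0, hq0, hf0⟩ := exists_isFinitaryFactorOfIID_withSingletons hp hexp
  have hmem : (q0 : ℝ) ∈ T := ⟨q0, rfl, hq0, hf0⟩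
  have hlb : ∀ x ∈ T, 0 ≤ x := by
    rintro _ ⟨q, rfl, -⟩
    exact q.2.1
  have hbdd : BddBelow T := ⟨0, hlb⟩
  refine ⟨sInf T, le_csInf ⟨_, hmem⟩ hlb, (csInf_le hbdd hmem).trans_lt hq0,
    fun q hq => ⟨fun hc => ?_, fun hc hf => ?_⟩⟩
  · obtain ⟨_, ⟨q1, rfl, hq1, hf⟩, hlt⟩ := exists_lt_of_csInf_lt ⟨_, hmem⟩ hc
    exact isFinitaryFactorOfIID_withSingletons_mono hlt.le hq1 hf
  · exact absurd (csInf_le hbdd ⟨q, rfl, hq, hf⟩) (not_le.2 hc)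

end Threshold

/-! ### A decay estimate that every finitary factor satisfies -/

section Obstruction

variable {d : ℕ}

theorem measurePreserving_shift {S : Type*} [MeasurableSpace S] (μ : Measure S)
    [IsProbabilityMeasure μ] (v : Fin d → ℤ) :
    MeasurePreserving (shift v) (Measure.infinitePi fun _ : Fin d → ℤ => μ)
      (Measure.infinitePi fun _ : Fin d → ℤ => μ) where
  measurable := measurable_pi_iff.2 fun _ => measurable_pi_apply _
  map_eq := Measure.map_infinitePi_infinitePi_of_inj (P := fun _ : Fin d → ℤ => μ)
    (f := fun w : Fin d → ℤ => w - v) (sub_left_injective)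

/-- For a finitary factor of an IID process, the probability that all sites of a sufficiently
sparse set are occupied decays at least as fast as for an IID process of slightly larger density. -/
theorem IsFinitaryFactorOfIID.exists_le_pow {ν : Measure ((Fin d → ℤ) → Bool)}
    (h : IsFinitaryFactorOfIID ν) {x : ENNReal} (hx : ν {y | y 0 = true} < x) :
    ∃ r : ℕ, ∀ A : Finset (Fin d → ℤ),
      (∀ a ∈ A, ∀ b ∈ A, a ≠ b → (2 * r : ℝ) < ‖a - b‖) →
        ν {y | ∀ a ∈ A, y a = true} ≤ x ^ A.card := by
  obtain ⟨S, _, _, μ, _, F, R, hR, hF, rfl, hshift, hfin, hF0⟩ := h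
  set P := Measure.infinitePi fun _ : Fin d → ℤ => μ with hP
  -- The origin is occupied or still undecided at radius r. This event is local and its probability
  -- decreases to the density. Its translates to points more than 2r apart depend on disjoint balls.
  let G : ℕ → Set ((Fin d → ℤ) → S) := fun r =>
    ((fun u => F u 0) ⁻¹' {false} ∩ {u | R u ≤ WithTop.some r})ᶜ
  have hGr : ∀ r, MeasurableSet[ballFiltration d S r] (G r) := fun r =>
    (((IsStoppingTime.measurableSet hR _).1 (hF0 (measurableSet_singleton false))).2 r).compl
  have hGm : ∀ r, MeasurableSet (G r) := fun r => (ballFiltration d S).le r _ (hGr r)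
  have hone : MeasurableSet {y : (Fin d → ℤ) → Bool | y 0 = true} :=
    (measurable_pi_apply 0 : Measurable fun y : (Fin d → ℤ) → Bool => y 0)
      (measurableSet_singleton true)
  have hlim : Filter.Tendsto (fun r => P (G r)) Filter.atTop (nhds (P (⋂ r, G r))) := by
    refine tendsto_measure_iInter_atTop (fun r => (hGm r).nullMeasurableSet) ?_
      ⟨0, measure_ne_top _ _⟩
    intro r r' hrr u hu hu'
    exact hu ⟨hu'.1, le_trans hu'.2 (WithTop.coe_le_coe.2 hrr)⟩
  have hlt : P (⋂ r, G r) < x := by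
    refine lt_of_le_of_lt ?_ hx
    rw [Measure.map_apply hF hone]
    refine measure_mono_ae ?_
    filter_upwards [hfin] with u hu hG
    obtain ⟨r, hr⟩ := WithTop.ne_top_iff_exists.1 hu
    have hGu := Set.mem_iInter.1 hG r
    by_contra hne
    exact hGu ⟨Bool.eq_false_of_not_eq_true hne, hr.ge⟩
  obtain ⟨r, hr⟩ := (hlim.eventually_lt_const hlt).exists
  refine ⟨r, fun A hA => ?_⟩
  have hall : MeasurableSet {y : (Fin d → ℤ) → Bool | ∀ a ∈ A, y a = true} := by
    have : {y : (Fin d → ℤ) → Bool | ∀ a ∈ A, y a = true} = ⋂ a ∈ A, (fun y => y a) ⁻¹' {true} := by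
      ext; simp
    rw [this]
    exact A.measurableSet_biInter fun a _ => measurable_pi_apply a (measurableSet_singleton true)
  rw [Measure.map_apply hF hall]
  calc P (F ⁻¹' {y | ∀ a ∈ A, y a = true})
      ≤ P (⋂ a ∈ A, shift (-a) ⁻¹' G r) := by
        refine measure_mono_ae ?_
        filter_upwards [ae_all_iff.2 hshift] with u hu hFu
        refine Set.mem_iInter₂.2 fun a ha hG => ?_
        have h1 : F (shift (-a) u) 0 = F u a := by rw [hu (-a)]; simp [shift]
        have h2 : F u a = true := hFu a ha
        have h3 : F (shift (-a) u) 0 = false := hG.1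
        rw [h1, h2] at h3
        simp at h3
    _ = ∏ a ∈ A, P (shift (-a) ⁻¹' G r) := by
        refine infinitePi_biInter_of_dependsOn _ A (fun a => {w | ‖w - a‖ ≤ (r : ℝ)}) _
          (fun a _ => (measurePreserving_shift μ (-a)).measurable (hGm r)) (fun a _ u w h hu => ?_) ?_
        · refine dependsOnCoords_of_measurableSet (hGr r) (shift (-a) u) (shift (-a) w)
            (fun i hi => ?_) hu
          refine h _ ?_
          simpa using hi
        · intro a ha b hb hab
          refine Set.disjoint_left.2 fun w hwa hwb => ?_
          have h1 : ‖w - a‖ ≤ (r : ℝ) := hwa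
          have h2 : ‖w - b‖ ≤ (r : ℝ) := hwb
          have h3 := norm_sub_le (w - b) (w - a)
          have h4 := hA a ha b hb hab
          rw [sub_sub_sub_cancel_left] at h3
          linarith
    _ = P (G r) ^ A.card := by
        refine Finset.prod_eq_pow_card fun a _ => ?_
        exact (measurePreserving_shift μ (-a)).measure_preimage (hGm r).nullMeasurableSet
    _ ≤ x ^ A.card := pow_le_pow_left₀ zero_le hr.le _

end Obstruction

/-! ### Elementary bounds for the union -/

section UnionBounds

variable {V : Type*} [Countable V]

theorem le_unionLaw (p : Finset V → I) {A : Finset V} (hA : A.Nonempty) :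
    weight (p A) ≤ unionLaw p {y | ∀ a ∈ A, y a = true} := by
  have hall : MeasurableSet {y : V → Bool | ∀ a ∈ A, y a = true} := by
    have : {y : V → Bool | ∀ a ∈ A, y a = true} = ⋂ a ∈ A, (fun y => y a) ⁻¹' {true} := by
      ext; simp
    rw [this]
    exact A.measurableSet_biInter fun a _ => measurable_pi_apply a (measurableSet_singleton true)
  rw [unionLaw, Measure.map_apply measurable_union hall]
  calc weight (p A) = bernoulliFamily p ((fun X => X ⟨A, hA⟩) ⁻¹' {true}) := by
        rw [← Measure.map_apply (measurable_pi_apply _) (measurableSet_singleton _),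
          bernoulliFamily, Measure.infinitePi_map_eval,
          bernoulliMeasure_apply_of_mem_of_notMem _ (measurableSet_singleton _) (by simp) (by simp),
          coe_toNNReal_eq_weight]
    _ ≤ _ := by
        refine measure_mono fun X hX a ha => ?_
        simp only [union, decide_eq_true_eq]
        exact ⟨⟨A, hA⟩, ha, hX⟩

theorem unionLaw_le_tsum (p : Finset V → I) (v : V) :
    unionLaw p {y | y v = true} ≤ ∑' A : {A : Finset V // v ∈ A}, weight (p A.1) := by
  have h1 : MeasurableSet {y : V → Bool | y v = true} :=
    (measurable_pi_apply v : Measurable fun y : V → Bool => y v) (measurableSet_singleton true)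
  rw [unionLaw, Measure.map_apply measurable_union h1]
  have : union ⁻¹' {y : V → Bool | y v = true} ⊆ ⋃ A : {A : Finset V // v ∈ A},
      (fun X : {A : Finset V // A.Nonempty} → Bool => X ⟨A.1, v, A.2⟩) ⁻¹' {true} := by
    intro X hX
    simp only [union, Set.mem_preimage, Set.mem_ofPred_eq, decide_eq_true_eq] at hX
    obtain ⟨A, hv, hA⟩ := hX
    exact Set.mem_iUnion.2 ⟨⟨A.1, hv⟩, hA⟩
  refine (measure_mono this).trans ((measure_iUnion_le _).trans (ENNReal.tsum_le_tsum fun A => ?_))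
  rw [← Measure.map_apply (measurable_pi_apply _) (measurableSet_singleton _),
    bernoulliFamily, Measure.infinitePi_map_eval,
    bernoulliMeasure_apply_of_mem_of_notMem _ (measurableSet_singleton _) (by simp) (by simp),
    coe_toNNReal_eq_weight]

end UnionBounds

/-! ### Sparse progressions: a family with a positive threshold -/

section Example

variable {d : ℕ}

/-- The points `0, n e, 2 n e, …, (n - 1) n e`, where `e` is the unit vector in direction `k`. -/
def progression (k : Fin d) (n : ℕ) : Finset (Fin d → ℤ) :=
  (Finset.range n).image fun i => Pi.single k ((n * i : ℕ) : ℤ)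

theorem card_progression (k : Fin d) (n : ℕ) : (progression k n).card = n := by
  rw [progression, Finset.card_image_of_injOn, Finset.card_range]
  intro i hi j _ hij
  have h := Pi.single_injective k hij
  have hn : 0 < n := lt_of_le_of_lt (Nat.zero_le i) (Finset.mem_range.1 hi)
  exact Nat.eq_of_mul_eq_mul_left hn (by exact_mod_cast h)

theorem le_norm_of_mem_progression {k : Fin d} {n : ℕ} {a b : Fin d → ℤ}
    (ha : a ∈ progression k n) (hb : b ∈ progression k n) (hab : a ≠ b) :
    (n : ℝ) ≤ ‖a - b‖ := by
  obtain ⟨i, -, rfl⟩ := Finset.mem_image.1 ha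
  obtain ⟨j, -, rfl⟩ := Finset.mem_image.1 hb
  have hij : (i : ℤ) - j ≠ 0 := by
    intro h
    apply hab
    rw [show i = j by omega]
  have h1 : (1 : ℤ) ≤ |(i : ℤ) - j| := Int.one_le_abs hij
  refine le_trans ?_ (norm_le_pi_norm _ k)
  simp only [Pi.sub_apply, Pi.single_eq_same]
  rw [Int.norm_eq_abs]
  have h2 : (n : ℤ) ≤ |((n * i : ℕ) : ℤ) - ((n * j : ℕ) : ℤ)| := by
    push_cast
    rw [← mul_sub, abs_mul, Nat.abs_cast]
    exact le_mul_of_one_le_right (by positivity) h1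
  exact_mod_cast h2

/-- One tenth, as a point of the unit interval. -/
noncomputable def tenth : I := ⟨1 / 10, by norm_num, by norm_num⟩

open Classical in
/-- Every translate of the progression with `n` points and step `n` has weight `10^{-(n+1)}`. -/
noncomputable def progressionFamily (k : Fin d) (A : Finset (Fin d → ℤ)) : I :=
  if ∃ v, A = translate (progression k A.card) v then tenth ^ (A.card + 1) else 0

theorem progressionFamily_translate (k : Fin d) (A : Finset (Fin d → ℤ)) (v : Fin d → ℤ) :
    progressionFamily k (translate A v) = progressionFamily k A := by
  have : (∃ w, translate A v = translate (progression k A.card) w) ↔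
      ∃ w, A = translate (progression k A.card) w := by
    constructor
    · rintro ⟨w, h⟩
      refine ⟨w - v, ?_⟩
      have := congrArg (translate · (-v)) h
      simpa [translate_translate, sub_eq_add_neg] using this
    · rintro ⟨w, h⟩
      exact ⟨w + v, by rw [← translate_translate, ← h]⟩
  rw [progressionFamily, progressionFamily, card_translate]
  classical
  exact if_congr this rfl rfl

theorem coe_progressionFamily_le (k : Fin d) (A : Finset (Fin d → ℤ)) :
    (progressionFamily k A : ℝ) ≤ (1 / 10) ^ (A.card + 1) := by
  rw [progressionFamily]
  split_ifs
  · simp [tenth]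
  · simp

open Classical in
/-- A sum over the sets containing the origin, in which a set of size `n` has weight at most `φ n`
and only translates of progressions occur. -/
theorem tsum_progressionFamily_le (k : Fin d) (f : Finset (Fin d → ℤ) → ENNReal) (φ : ℕ → ENNReal)
    (hf : ∀ A, f A ≤ φ A.card) (hf0 : ∀ A, progressionFamily k A = 0 → f A = 0) :
    ∑' A : {A : Finset (Fin d → ℤ) // 0 ∈ A}, f A.1 ≤ ∑' n : ℕ, n * φ n := by
  -- The translates of the n-point progression that contain the origin: one for each of its points,
  -- moved to the origin. Hence the factor n.
  let g : (Σ n : ℕ, Fin n) → Finset (Fin d → ℤ) := fun x =>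
    translate (progression k x.1) (-Pi.single k ((x.1 * x.2 : ℕ) : ℤ))
  have h1 : ∀ A : {A : Finset (Fin d → ℤ) // 0 ∈ A},
      f A.1 ≤ ∑' x : Σ n : ℕ, Fin n, if A.1 = g x then φ x.1 else 0 := by
    intro A
    by_cases h0 : progressionFamily k A.1 = 0
    · rw [hf0 _ h0]
      exact zero_le
    · have hv : ∃ v, A.1 = translate (progression k A.1.card) v := by
        by_contra hv
        exact h0 (by rw [progressionFamily, if_neg hv])
      obtain ⟨v, hv⟩ := hv
      have h0A := A.2
      rw [hv, mem_translate, zero_sub] at h0A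
      obtain ⟨i, hi, hiv⟩ := Finset.mem_image.1 h0A
      have hg : A.1 = g ⟨A.1.card, i, Finset.mem_range.1 hi⟩ := by
        simp only [g]
        rw [hiv, neg_neg]
        exact hv
      refine le_trans ?_ (ENNReal.le_tsum ⟨A.1.card, i, Finset.mem_range.1 hi⟩)
      rw [if_pos hg]
      exact hf _
  calc ∑' A : {A : Finset (Fin d → ℤ) // 0 ∈ A}, f A.1
      ≤ ∑' (A : {A : Finset (Fin d → ℤ) // 0 ∈ A}) (x : Σ n : ℕ, Fin n),
          if A.1 = g x then φ x.1 else 0 := ENNReal.tsum_le_tsum h1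
    _ = ∑' (x : Σ n : ℕ, Fin n) (A : {A : Finset (Fin d → ℤ) // 0 ∈ A}),
          if A.1 = g x then φ x.1 else 0 := ENNReal.tsum_comm
    _ ≤ ∑' x : Σ n : ℕ, Fin n, φ x.1 := by
        refine ENNReal.tsum_le_tsum fun x => ?_
        by_cases hx : 0 ∈ g x
        · rw [tsum_eq_single ⟨g x, hx⟩]
          · simp
          · intro A hA
            exact if_neg fun h => hA (Subtype.ext h)
        · refine le_of_eq_of_le (ENNReal.tsum_eq_zero.2 fun A => if_neg fun h => hx ?_) zero_le
          rw [← h]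
          exact A.2
    _ = ∑' n : ℕ, n * φ n := by
        refine (ENNReal.tsum_sigma fun (n : ℕ) (_ : Fin n) => φ n).trans ?_
        simp

theorem hasExponentialMoment_progressionFamily (k : Fin d) :
    HasExponentialMoment (progressionFamily k) := by
  -- Any base below 10 would do; 5 leaves the geometric ratio 1/2.
  refine ⟨Real.log 5, Real.log_pos (by norm_num), ?_⟩
  set f : Finset (Fin d → ℤ) → ENNReal := fun A => ENNReal.ofReal
    ((progressionFamily k A : ℝ) * Real.exp (Real.log 5 * A.card)) with hf
  have hexp : ∀ n : ℕ, Real.exp (Real.log 5 * n) = 5 ^ n := fun n => by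
    rw [mul_comm, Real.exp_nat_mul, Real.exp_log (by norm_num)]
  have hle := tsum_progressionFamily_le k f (fun n => ENNReal.ofReal ((1 / 2) ^ n))
    (fun A => ENNReal.ofReal_le_ofReal (by
      rw [hexp]
      calc (progressionFamily k A : ℝ) * 5 ^ A.card
          ≤ (1 / 10) ^ (A.card + 1) * 5 ^ A.card :=
            mul_le_mul_of_nonneg_right (coe_progressionFamily_le k A) (by positivity)
        _ = (1 / 10) * (1 / 2) ^ A.card := by
            rw [pow_succ', mul_assoc, ← mul_pow]; norm_num
        _ ≤ (1 / 2) ^ A.card := mul_le_of_le_one_left (by positivity) (by norm_num)))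
    (fun A hA => by simp [hf, hA])
  have hsum : Summable fun n : ℕ => (n : ℝ) * (1 / 2) ^ n :=
    (hasSum_coe_mul_geometric_of_norm_lt_one (by norm_num : ‖(1 / 2 : ℝ)‖ < 1)).summable
  have hfin : ∑' n : ℕ, (n : ENNReal) * ENNReal.ofReal ((1 / 2) ^ n) ≠ ⊤ := by
    convert hsum.tsum_ofReal_ne_top using 3 with n
    rw [ENNReal.ofReal_mul (Nat.cast_nonneg n), ENNReal.ofReal_natCast]
  have := ENNReal.summable_toReal (ne_top_of_le_ne_top hfin hle)
  refine this.congr fun A => ?_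
  exact ENNReal.toReal_ofReal (mul_nonneg (progressionFamily k A.1).2.1 (Real.exp_pos _).le)

/-- The bound is Σ n 10^{-(n+1)} = 1/81. -/
theorem tsum_weight_progressionFamily_le (k : Fin d) :
    ∑' A : {A : Finset (Fin d → ℤ) // 0 ∈ A}, weight (progressionFamily k A.1)
      ≤ ENNReal.ofReal (1 / 81) := by
  refine (tsum_progressionFamily_le k (fun A => weight (progressionFamily k A))
    (fun n => ENNReal.ofReal ((1 / 10) ^ (n + 1)))
    (fun A => ENNReal.ofReal_le_ofReal (coe_progressionFamily_le k A))
    (fun A hA => by simp [hA, weight])).trans ?_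
  have h1 := hasSum_coe_mul_geometric_of_norm_lt_one (by norm_num : ‖(1 / 10 : ℝ)‖ < 1)
  have h2 := h1.mul_left (1 / 10)
  have h3 : ∀ n : ℕ, (n : ENNReal) * ENNReal.ofReal ((1 / 10) ^ (n + 1))
      = ENNReal.ofReal (1 / 10 * (n * (1 / 10) ^ n)) := by
    intro n
    rw [← ENNReal.ofReal_natCast, ← ENNReal.ofReal_mul (Nat.cast_nonneg n)]
    congr 1
    ring
  simp only [h3]
  rw [← ENNReal.ofReal_tsum_of_nonneg (fun n => by positivity) h2.summable, h2.tsum_eq]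
  exact ENNReal.ofReal_le_ofReal (by norm_num)

/-- The density is at most 1/100 + 1/81 < 1/20, so a finitary coding would make a sparse n-point
progression fully occupied with probability at most 20^{-n}. Selecting the progression itself
already has probability 10^{-(n+1)}, which is larger once 2^n > 10. -/
theorem not_isFinitaryFactorOfIID_progressionFamily (k : Fin d) {q : I} (hq : (q : ℝ) ≤ 1 / 100) :
    ¬ IsFinitaryFactorOfIID (unionLaw (withSingletons (progressionFamily k) q)) := by
  classical
  intro h
  set p := withSingletons (progressionFamily k) q with hp
  have hdens : unionLaw p {y | y 0 = true} < ENNReal.ofReal (1 / 20) := by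
    have h1 : ∀ A : {A : Finset (Fin d → ℤ) // 0 ∈ A}, weight (p A.1)
        ≤ (if A = ⟨{0}, by simp⟩ then weight q else 0) + weight (progressionFamily k A.1) := by
      intro A
      by_cases hA : A.1.card = 1
      · obtain ⟨v, hv⟩ := Finset.card_eq_one.1 hA
        have hv0 : v = 0 := by
          have := A.2
          rw [hv, Finset.mem_singleton] at this
          exact this.symm
        have hA0 : A = ⟨{0}, by simp⟩ := Subtype.ext (by rw [hv, hv0])
        rw [if_pos hA0, hp, withSingletons, if_pos hA]
        exact le_self_add
      · rw [hp, withSingletons, if_neg hA]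
        exact le_add_self
    calc unionLaw p {y | y 0 = true}
        ≤ ∑' A : {A : Finset (Fin d → ℤ) // 0 ∈ A}, weight (p A.1) := unionLaw_le_tsum p 0
      _ ≤ weight q + ENNReal.ofReal (1 / 81) := by
          refine (ENNReal.tsum_le_tsum h1).trans ?_
          rw [ENNReal.tsum_add, tsum_ite_eq]
          exact add_le_add_right (tsum_weight_progressionFamily_le k) _
      _ ≤ ENNReal.ofReal (1 / 100 + 1 / 81) := by
          rw [ENNReal.ofReal_add (by norm_num) (by norm_num)]
          exact add_le_add_left (ENNReal.ofReal_le_ofReal hq) _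
      _ < ENNReal.ofReal (1 / 20) := (ENNReal.ofReal_lt_ofReal_iff (by norm_num)).2 (by norm_num)
  obtain ⟨r, hr⟩ := h.exists_le_pow hdens
  set n := 2 * r + 4 with hn
  have hcard := card_progression k n
  have hne : (progression k n).Nonempty := by
    rw [← Finset.card_pos, hcard]
    omega
  have h1 := hr (progression k n) fun a ha b hb hab => by
    refine lt_of_lt_of_le ?_ (le_norm_of_mem_progression ha hb hab)
    rw [hn]
    push_cast
    linarith
  have h2 := (le_unionLaw p hne).trans h1
  have hpn : p (progression k n) = tenth ^ (n + 1) := by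
    rw [hp, withSingletons, if_neg (by omega), progressionFamily, hcard, if_pos ⟨0, by simp⟩]
  rw [hpn, hcard, ← ENNReal.ofReal_pow (by norm_num), weight,
    ENNReal.ofReal_le_ofReal_iff (by positivity)] at h2
  have h3 : (2 : ℝ) ^ 4 ≤ 2 ^ n := pow_le_pow_right₀ (by norm_num) (by omega)
  have h4 : ((tenth ^ (n + 1) : I) : ℝ) = (1 / 10) * (2 ^ n * (1 / 20) ^ n) := by
    rw [← mul_pow]
    simp only [tenth]
    push_cast
    rw [pow_succ']
    norm_num
  rw [h4] at h2
  have h5 : (0 : ℝ) < (1 / 20) ^ n := by positivity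
  nlinarith

theorem exists_nontrivial_threshold (hd : 1 ≤ d) :
    ∃ p : Finset (Fin d → ℤ) → I, TranslationInvariant p ∧
      (∀ A : Finset (Fin d → ℤ), A.Nonempty → (p A : ℝ) < 1) ∧ HasExponentialMoment p ∧
      ∃ c : ℝ, 0 < c ∧ c < 1 ∧ IsSingletonThreshold p c := by
  let k : Fin d := ⟨0, hd⟩
  have hp : TranslationInvariant (progressionFamily k) :=
    fun A v _ => progressionFamily_translate k A v
  have hexp := hasExponentialMoment_progressionFamily k
  obtain ⟨c, -, hc1, hc⟩ := exists_isSingletonThreshold hp hexp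
  refine ⟨progressionFamily k, hp, fun A _ => ?_, hexp, c, ?_, hc1, hc⟩
  · exact (coe_progressionFamily_le k A).trans_lt
      (pow_lt_one₀ (by norm_num) (by norm_num) (Nat.succ_ne_zero _))
  · by_contra hc0
    let q : I := ⟨1 / 100, by norm_num, by norm_num⟩
    have hq : (q : ℝ) = 1 / 100 := rfl
    exact not_isFinitaryFactorOfIID_progressionFamily k hq.le
      ((hc q (by rw [hq]; norm_num)).1 (by rw [hq]; linarith))

end Example

end RandomUnion

theorem theorem1p3 (d : ℕ) (hd : 1 ≤ d) :
    -- the sufficient condition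
    (∀ p : Finset (Fin d → ℤ) → unitInterval,
      RandomUnion.TranslationInvariant p →
      (∀ A : Finset (Fin d → ℤ), A.Nonempty → (p A : ℝ) < 1) →
      0 < (p {0} : ℝ) →
      (Summable fun A : {A : Finset (Fin d → ℤ) // 0 ∈ A} =>
        (p A.1 : ℝ) * ((p {0} : ℝ)⁻¹) ^ A.1.card) →
      RandomUnion.IsFinitaryFactorOfIID (RandomUnion.unionLaw p)) ∧
    -- there is always a threshold below one when some exponential moment is finite
    (∀ p : Finset (Fin d → ℤ) → unitInterval,
      RandomUnion.TranslationInvariant p →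
      (∀ A : Finset (Fin d → ℤ), A.Nonempty → (p A : ℝ) < 1) →
      RandomUnion.HasExponentialMoment p →
      ∃ c : ℝ, 0 ≤ c ∧ c < 1 ∧ RandomUnion.IsSingletonThreshold p c) ∧
    -- and the transition is nontrivial for some families
    (∃ p : Finset (Fin d → ℤ) → unitInterval,
      RandomUnion.TranslationInvariant p ∧
      (∀ A : Finset (Fin d → ℤ), A.Nonempty → (p A : ℝ) < 1) ∧
      RandomUnion.HasExponentialMoment p ∧
      ∃ c : ℝ, 0 < c ∧ c < 1 ∧ RandomUnion.IsSingletonThreshold p c) :=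
  ⟨fun _ hp _ h0 hsum => RandomUnion.isFinitaryFactorOfIID_unionLaw hp h0 hsum,
    fun _ hp _ hexp => RandomUnion.exists_isSingletonThreshold hp hexp,
    RandomUnion.exists_nontrivial_threshold hd⟩
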